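/- **Setting.** Let $X\subset\mathbb R^d$ be a closed convex set with nonempty interior, and let $\phi:X\to\mathbb R\cup\{\infty\}$ be lower semicontinuous, strongly convex and of Legendre type, finite and $C^3$ on $\operatorname{int}X$ (Legendre type: $\|\nabla\phi(x)\|\to\infty$ as $x\in\operatorname{int}X$ tends to a boundary point of $X$). Let $\phi^*(y)=\sup_{x\in X}\langle x,y\rangle-\phi(x)$, so that $\nabla\phi^*=(\nabla\phi)^{-1}:\mathbb R^d\to\operatorname{int}X$. Let $\pi\propto e^{-V}$ be a probability measure on $X$ with $V$ smooth on $\operatorname{int} X$, let $\nu=(\nabla\phi)_\#\pi$ be the mirrored target, and let $W(y)=V(x)+\log\det\nabla^2\phi(x)$ with $x=\nabla\phi^*(y)$, so that $\nu\propto e^{-W}$. The Langevin generator $\mathcal L_\nu$ is the operator on $L^2(\nu)$ obtained as the closure of $\mathcal L_\nu f=\Delta f-\langle\nabla W,\nabla f\rangle$, $f\in C_c^\infty(\mathbb R^d)$. For a kernel $k:X\times X\to\mathbb R$ let $k_\phi(y,y')=k(\nabla\phi^*(y),\nabla\phi^*(y'))$ and $P_{\nu,k_\phi}f=\int k_\phi(x,\cdot)f(x)\,\mathrm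 d\nu(x)$ (the integral being absolutely convergent $\nu$-a.e. for every $f\in L^2(\nu)$). The *mirrored Laplacian-adjusted Wasserstein gradient flow* is $\mu_t=(\nabla\phi^*)_\#\eta_t$, $t\ge0$, where the probability measures $\eta_t$ on $\mathbb R^d$ have Lebesgue densities (also denoted $\eta_t$) that form a classical solution of $$\frac{\partial\eta_t}{\partial t}-\nabla\cdot\Big(\eta_t\,\nabla P_{\nu,k_\phi}\Big(\frac{\eta_t}{\nu}\Big)\Big)=0,\qquad t>0.$$ Classical solution means: $(t,y)\mapsto\eta_t(y)$ is $C^1$ on $(0,\infty)\times\mathbb R^d$; $\eta_t\to\eta_0$ in $L^1(\mathbb R^d)$ as $t\downarrow0$; for every $t>0$, $\eta_t/\nu\in L^2(\nu)$ and $P_{\nu,k_\phi}(\eta_t/\nu)$ has a $C^2$ version; $\int_a^b\int\|\nabla P_{\nu,k_\phi}(\eta_t/\nu)\|\,\mathrm d\eta_t\,\mathrm dt<\infty$ for all $0<a<b$; and the equation holds pointwise. **Proposition.** Assume that $\pi$ satisfies a mirrored Poincaré inequality: for some $\kappa>0$, $$\mathrm{Var}_\pi[g]\le\frac1\kappa\big\|[\nabla^2\phi]^{-1}\nabla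 g\big\|_{L^2(\pi)}^2\qquad\text{for all locally Lipschitz } g\in L^2(\pi).$$ Suppose that $\mathcal L_\nu$ has discrete spectrum (every point of the spectrum is isolated in the spectrum and an eigenvalue of finite multiplicity), and that the kernel is chosen such that $P_{\nu,k_\phi}=-\mathcal L_\nu^{-1}$, the inverse being understood modulo constants: for $f\in L^2(\nu)$, $g=P_{\nu,k_\phi}f$ is in the domain of $\mathcal L_\nu$, $\int g\,\mathrm d\nu=0$ and $-\mathcal L_\nu g=f-\int f\,\mathrm d\nu$. Then, along every mirrored Laplacian-adjusted Wasserstein gradient flow $(\mu_t)_{t\ge0}$, $$\mathrm{KL}(\mu_t\|\pi)\le\mathrm{KL}(\mu_0\|\pi)\,e^{-t}\quad\text{for all }t\ge0,$$ $$\mathrm{KL}(\mu_t\|\pi)\le\big(\mathrm{KL}(\mu_0\|\pi)\wedge2\big)\,e^{-t}\quad\text{for all }t\ge1.$$ In particular the rate does not depend on $\kappa$. (The case $\mathrm{KL}(\mu_0\|\pi)=\infty$ is allowed.) -/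

import Mathlib

open MeasureTheory ProbabilityTheory Set Filter Topology
open scoped ContDiff

noncomputable section

namespace MirroredFlow

/-- The Euclidean space `ℝ^d`. -/
abbrev Euc (d : ℕ) : Type := EuclideanSpace ℝ (Fin d)

variable {d : ℕ}

/-! ### Mirror maps -/

/-- The effective domain of an extended-real-valued function. -/
def effDom (φ : Euc d → EReal) : Set (Euc d) := {x | φ x ≠ ⊤}

/-- The finite values of `φ`. -/
def realPart (φ : Euc d → EReal) (x : Euc d) : ℝ := (φ x).toReal

/-- The mirror map `∇φ` (meaningful on the interior of the constraint set). -/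
def mirrorMap (φ : Euc d → EReal) : Euc d → Euc d := gradient (realPart φ)

/-- The Hessian `∇²φ(x)`, as a linear map. -/
def hessian (φ : Euc d → EReal) (x : Euc d) : Euc d →L[ℝ] Euc d := fderiv ℝ (mirrorMap φ) x

/-- The Fenchel conjugate `φ*(y) = sup_{x ∈ X} ⟨x, y⟩ - φ(x)`. -/
def conjugate (X : Set (Euc d)) (φ : Euc d → EReal) (y : Euc d) : ℝ :=
  (⨆ x ∈ X, ((inner ℝ x y : ℝ) : EReal) - φ x).toReal

/-- The inverse mirror map `∇φ*`. -/
def dualMap (X : Set (Euc d)) (φ : Euc d → EReal) : Euc d → Euc d := gradient (conjugate X φ)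

/-- `X` is a closed convex domain and `φ : X → ℝ ∪ {∞}` (extended by `∞` outside `X`) is a proper,
lower semicontinuous, strongly convex function of Legendre type, finite and three times
continuously differentiable in the interior of `X`. (Strict convexity, the last part of the
definition of Legendre type, is implied by strong convexity; `φ` is proper because it is finite on
the nonempty interior of `X`.) -/
structure IsMirrorFunction (X : Set (Euc d)) (φ : Euc d → EReal) : Prop where
  closed : IsClosed X
  convex : Convex ℝ X
  nonempty_interior : (interior X).Nonempty
  ne_bot : ∀ x, φ x ≠ ⊥
  eq_top : ∀ x, x ∉ X → φ x = ⊤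
  finite_interior : interior X ⊆ effDom φ
  lsc : LowerSemicontinuous φ
  strongConvex : ∃ m : ℝ, 0 < m ∧ StrongConvexOn (effDom φ) m (realPart φ)
  contDiff : ContDiffOn ℝ 3 (realPart φ) (interior X)
  steep : ∀ x ∈ frontier X, Tendsto (fun z => ‖mirrorMap φ z‖) (𝓝[interior X] x) atTop

/-! ### The target and the mirrored target -/

/-- `π` is a probability measure on `X` with density proportional to `e^{-V}`, `V` smooth. -/
structure IsTarget (X : Set (Euc d)) (V : Euc d → ℝ) (π : Measure (Euc d)) : Prop where
  smooth : ContDiffOn ℝ ∞ V (interior X)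
  prob : IsProbabilityMeasure π
  density : π = (∫⁻ x in X, ENNReal.ofReal (Real.exp (-V x)))⁻¹ •
    (volume.restrict X).withDensity (fun x => ENNReal.ofReal (Real.exp (-V x)))

/-- The mirrored target `ν = (∇φ)_# π`. -/
def mirrored (φ : Euc d → EReal) (π : Measure (Euc d)) : Measure (Euc d) := π.map (mirrorMap φ)

/-- The potential of the mirrored target, `W(∇φ(x)) = V(x) + log det ∇²φ(x)`. -/
def mirroredPotential (X : Set (Euc d)) (φ : Euc d → EReal) (V : Euc d → ℝ) (y : Euc d) : ℝ :=
  V (dualMap X φ y) + Real.log (hessian φ (dualMap X φ y)).det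

/-- The mirrored Poincaré inequality with constant `κ`:
`Var_π[g] ≤ κ⁻¹ ‖[∇²φ]⁻¹ ∇g‖²_{L²(π)}` for all locally Lipschitz `g ∈ L²(π)`. -/
def MirroredPoincare (X : Set (Euc d)) (φ : Euc d → EReal) (π : Measure (Euc d)) (κ : ℝ) : Prop :=
  ∀ g : Euc d → ℝ, LocallyLipschitzOn (interior X) g → MemLp g 2 π →
    ENNReal.ofReal (variance g π) ≤
      ENNReal.ofReal (1 / κ) * ∫⁻ x, ‖(hessian φ x).inverse (gradient g x)‖ₑ ^ 2 ∂π

/-! ### The Langevin generator -/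

/-- The differential expression `L f = Δf - ⟨∇W, ∇f⟩`. -/
def langevin (W : Euc d → ℝ) (f : Euc d → ℝ) (y : Euc d) : ℝ :=
  Laplacian.laplacian f y - inner ℝ (gradient W y) (gradient f y)

theorem langevin_add (W : Euc d → ℝ) {f g : Euc d → ℝ} (hf : ContDiff ℝ ∞ f)
    (hg : ContDiff ℝ ∞ g) : langevin W (f + g) = langevin W f + langevin W g := by
  have two : (2 : WithTop ℕ∞) ≤ ∞ := WithTop.coe_le_coe.2 (le_top : (2 : ℕ∞) ≤ ⊤)
  funext y
  have h1 := (hf.of_le two).contDiffAt (x := y)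
  have h2 := (hg.of_le two).contDiffAt (x := y)
  have h3 := h1.laplacian_add h2
  have h4 : gradient (f + g) y = gradient f y + gradient g y := by
    simp only [gradient]
    rw [fderiv_add (h1.differentiableAt (by norm_num)) (h2.differentiableAt (by norm_num)), map_add]
  simp only [langevin, Pi.add_apply, h3, h4, inner_add_right]
  ring

theorem langevin_smul (W : Euc d → ℝ) (c : ℝ) {f : Euc d → ℝ} (hf : ContDiff ℝ ∞ f) :
    langevin W (c • f) = c • langevin W f := by
  have two : (2 : WithTop ℕ∞) ≤ ∞ := WithTop.coe_le_coe.2 (le_top : (2 : ℕ∞) ≤ ⊤)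
  funext y
  have h1 := (hf.of_le two).contDiffAt (x := y)
  have h3 := InnerProductSpace.laplacian_smul c h1
  have h4 : gradient (c • f) y = c • gradient f y := by
    simp only [gradient]
    rw [fderiv_const_smul (h1.differentiableAt (by norm_num)), map_smul]
  simp only [langevin, Pi.smul_apply, h3, h4, inner_smul_right, smul_eq_mul]
  ring

/-- The graph of the Langevin operator on test functions, as a subspace of `L²(ν) × L²(ν)`. -/
def langevinCore (W : Euc d → ℝ) (ν : Measure (Euc d)) : Submodule ℝ (Lp ℝ 2 ν × Lp ℝ 2 ν) where
  carrier := {p | ∃ ψ : Euc d → ℝ, ContDiff ℝ ∞ ψ ∧ HasCompactSupport ψ ∧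
    p.1 =ᵐ[ν] ψ ∧ p.2 =ᵐ[ν] langevin W ψ}
  add_mem' := by
    rintro p q ⟨f, hf, hfc, hf1, hf2⟩ ⟨g, hg, hgc, hg1, hg2⟩
    refine ⟨f + g, hf.add hg, hfc.add hgc, (Lp.coeFn_add _ _).trans (hf1.add hg1), ?_⟩
    rw [langevin_add W hf hg]
    exact (Lp.coeFn_add _ _).trans (hf2.add hg2)
  zero_mem' := by
    refine ⟨0, contDiff_const, HasCompactSupport.zero, Lp.coeFn_zero _ _ _, ?_⟩
    have h : langevin W (0 : Euc d → ℝ) = 0 := by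
      have := langevin_smul W 0 (f := (0 : Euc d → ℝ)) contDiff_const
      simpa using this
    rw [h]
    exact Lp.coeFn_zero _ _ _
  smul_mem' := by
    rintro c p ⟨f, hf, hfc, hf1, hf2⟩
    refine ⟨c • f, hf.const_smul c, hfc.smul_left (f := fun _ => c),
      (Lp.coeFn_smul _ _).trans (hf1.const_smul c), ?_⟩
    rw [langevin_smul W c hf]
    exact (Lp.coeFn_smul _ _).trans (hf2.const_smul c)

/-- The generator `L_ν` in `L²(ν)` of the Langevin diffusion with stationary law `ν ∝ e^{-W}`: the
closure of the Langevin operator on `C_c^∞(ℝ^d)`. The operator is represented by its graph. -/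
def generator (W : Euc d → ℝ) (ν : Measure (Euc d)) : Submodule ℝ (Lp ℝ 2 ν × Lp ℝ 2 ν) :=
  (langevinCore W ν).topologicalClosure

/-- The spectrum of a (self-adjoint) closed operator given by its graph `A`: `c` is in the resolvent
set iff `c u - A u = f` has a unique solution `u` in the domain for every `f`. -/
def graphSpectrum {H : Type*} [AddCommGroup H] [Module ℝ H] (A : Submodule ℝ (H × H)) : Set ℝ :=
  {c | ¬ ∀ f : H, ∃! u : H, (u, c • u - f) ∈ A}

/-- The eigenspace `{u | A u = c u}` of an operator given by its graph. -/
def graphEigenspace {H : Type*} [AddCommGroup H] [Module ℝ H] (A : Submodule ℝ (H × H)) (c : ℝ) :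
    Submodule ℝ H :=
  A.comap (LinearMap.prod LinearMap.id (c • LinearMap.id))

/-- Discrete spectrum: every point of the spectrum is isolated in the spectrum and is an eigenvalue
of finite multiplicity. -/
def HasDiscreteSpectrum {H : Type*} [AddCommGroup H] [Module ℝ H] (A : Submodule ℝ (H × H)) :
    Prop :=
  ∀ c ∈ graphSpectrum A,
    (∃ ε > 0, ∀ c' ∈ graphSpectrum A, |c' - c| < ε → c' = c) ∧
    graphEigenspace A c ≠ ⊥ ∧ FiniteDimensional ℝ (graphEigenspace A c)

/-! ### Kernels -/

/-- The kernel `k_φ(y, y') = k(∇φ*(y), ∇φ*(y'))` on the dual space. -/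
def dualKernel (X : Set (Euc d)) (φ : Euc d → EReal) (k : Euc d → Euc d → ℝ)
    (y y' : Euc d) : ℝ :=
  k (dualMap X φ y) (dualMap X φ y')

/-- The integral operator `P_{ν,k} f = ∫ k(x, ·) f(x) dν(x)`. -/
def kernelOp (ν : Measure (Euc d)) (k : Euc d → Euc d → ℝ) (f : Euc d → ℝ) (y : Euc d) : ℝ :=
  ∫ x, k x y * f x ∂ν

/-- `P_{ν,k} = -A⁻¹`, the inverse being taken on the orthogonal complement of the constants (the
kernel of the Langevin generator) and extended by zero to the constants: for every `f ∈ L²(ν)`,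
`g = P_{ν,k} f` is the function in the domain of `A` with `∫ g dν = 0` and `-A g = f - ∫ f dν`. -/
def IsNegInverse (ν : Measure (Euc d)) (k : Euc d → Euc d → ℝ)
    (A : Submodule ℝ (Lp ℝ 2 ν × Lp ℝ 2 ν)) : Prop :=
  ∀ f : Lp ℝ 2 ν,
    (∀ᵐ y ∂ν, Integrable (fun x => k x y * f x) ν) ∧
    ∃ g h : Lp ℝ 2 ν, g =ᵐ[ν] kernelOp ν k f ∧ ∫ y, g y ∂ν = 0 ∧
      h =ᵐ[ν] (fun y => f y - ∫ z, f z ∂ν) ∧ (g, -h) ∈ A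

/-! ### The flow -/

/-- The divergence of a vector field on `ℝ^d`. -/
def divergence (F : Euc d → Euc d) (y : Euc d) : ℝ :=
  ∑ i : Fin d, (fderiv ℝ F y (EuclideanSpace.single i 1)) i

/-- The density `η/ν` of `η` with respect to `ν`. -/
def relDensity (η ν : Measure (Euc d)) (y : Euc d) : ℝ := (η.rnDeriv ν y).toReal

/-- `(η_t)_{t ≥ 0}` is a classical solution of
`∂η_t/∂t - ∇ · (η_t ∇ P_{ν,k}(η_t/ν)) = 0`, with Lebesgue densities `q_t`. The initial datum is
attained in `L¹`, and `P_{ν,k}(η_t/ν) ∈ L²(ν)` has the `C²` representative `u_t`. -/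
structure IsLaplacianAdjustedFlow (ν : Measure (Euc d)) (k : Euc d → Euc d → ℝ)
    (η : ℝ → Measure (Euc d)) (q u : ℝ → Euc d → ℝ) : Prop where
  prob : ∀ t, 0 ≤ t → IsProbabilityMeasure (η t)
  nonneg : ∀ t, 0 ≤ t → ∀ y, 0 ≤ q t y
  measurable : ∀ t, 0 ≤ t → Measurable (q t)
  density : ∀ t, 0 ≤ t → η t = volume.withDensity (fun y => ENNReal.ofReal (q t y))
  initial : Tendsto (fun t => ∫⁻ y, ‖q t y - q 0 y‖ₑ) (𝓝[>] 0) (𝓝 0)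
  contDiff : ContDiffOn ℝ 1 (fun p : ℝ × Euc d => q p.1 p.2) (Ioi 0 ×ˢ univ)
  memLp : ∀ t, 0 < t → MemLp (relDensity (η t) ν) 2 ν
  contDiff_potential : ∀ t, 0 < t → ContDiff ℝ 2 (u t)
  potential : ∀ t, 0 < t → u t =ᵐ[ν] kernelOp ν k (relDensity (η t) ν)
  integrable_velocity : ∀ a b : ℝ, 0 < a → a < b →
    ∫⁻ t in Icc a b, ∫⁻ y, ‖gradient (u t) y‖ₑ ∂(η t) ≠ ⊤
  equation : ∀ t, 0 < t → ∀ y,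
    HasDerivAt (fun s => q s y) (divergence (fun z => q t z • gradient (u t) z) y) t

/-- `(μ_t)` is the mirrored Laplacian-adjusted Wasserstein gradient flow for the target `π`, with
mirror function `φ` and base kernel `k`: `μ_t = (∇φ*)_# η_t`, where `η_t` solves the
Laplacian-adjusted flow with target `ν = (∇φ)_# π` and kernel `k_φ`. -/
def IsMLAWGF (X : Set (Euc d)) (φ : Euc d → EReal) (π : Measure (Euc d))
    (k : Euc d → Euc d → ℝ) (μ : ℝ → Measure (Euc d)) : Prop :=
  ∃ (η : ℝ → Measure (Euc d)) (q u : ℝ → Euc d → ℝ),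
    IsLaplacianAdjustedFlow (mirrored φ π) (dualKernel X φ k) η q u ∧
    ∀ t, 0 ≤ t → μ t = (η t).map (dualMap X φ)

end MirroredFlow

end

noncomputable section

/-! Write `p` for the density of `ν`, `q_t` for that of `η_t`, and `u_t` for the potential. The
mirror map is a bijection from the interior of `X` onto `ℝ^d`, so relative entropy is the same on
either side (`IsTarget.klDiv_map_dualMap`), and everything happens for `η_t` and `ν ∝ e^{-W}`.

Since `P = -L⁻¹` modulo constants, `-L u_t = q_t/p - 1`. In divergence form this reads `div(p ∇u_t)
= p - q_t`, pointwise because `u_t` is `C²` (`IsLaplacianAdjustedFlow.divergence_eq`). The flow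
itself is `∂_t q_t = div(q_t ∇u_t)`. Put `b = b₀ eᵗ` and `m = (1 - b) q_t + b p`. Then `∂_t m = (1 -
b) div(q_t ∇u_t) + b (p - q_t) = div(m ∇u_t)`: the mixture is carried by the same velocity as `q_t`.
Any 1-homogeneous function of `(q, m)` is then carried too, in particular `q²/m`
(`hasDerivAt_flowRatio`). As `q²/m ≤ q/(1 - b)`, its flux is integrable on time intervals away from
`0`, so `∫ q²/m` is conserved; `L¹` continuity extends this to time `0`
(`IsLaplacianAdjustedFlow.integral_flowRatio_eq`).

Let `D_t(b) = b ∫ (q_t - p)²/((1 - b) q_t + b p) = b⁻¹ (∫ q_t²/m - 1)`. Conservation becomes the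
exact scaling law `D_t(b) = e^{-t} D_0(b e^{-t})` (`IsLaplacianAdjustedFlow.mixDiv_eq`). Relative
entropy is `∫₀¹ D_t(b) db` (`klDiv_eq_lintegral_mixDiv`). Monotonicity of `D_0` in `b` gives decay
at rate `e^{-t}`, with infinite values allowed. The a priori bound `D_0(b) ≤ 1/(1 - b)`, used at `b
e^{-t} ≤ 1/2`, gives the constant `2` once `t ≥ 1`. -/

/-- First order characterization of strong convexity. -/
theorem StrongConvexOn.le_of_hasFDerivAt {E : Type*} [NormedAddCommGroup E] [NormedSpace ℝ E]
    {s : Set E} {m : ℝ} {f : E → ℝ} (hf : StrongConvexOn s m f) {x z : E} (hx : x ∈ s)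
    (hz : z ∈ s) {f' : E →L[ℝ] ℝ} (hd : HasFDerivAt f f' x) :
    f x + f' (z - x) + m / 2 * ‖z - x‖ ^ 2 ≤ f z := by
  have h1 : Tendsto (fun t : ℝ => t⁻¹ • (f (x + t • (z - x)) - f x)) (𝓝[>] 0)
      (𝓝 (f' (z - x))) := (hd.hasLineDerivAt (z - x)).tendsto_slope_zero_right
  have h2 : Tendsto (fun t : ℝ => f z - f x - (1 - t) * (m / 2 * ‖z - x‖ ^ 2)) (𝓝[>] 0)
      (𝓝 (f z - f x - (1 - 0) * (m / 2 * ‖z - x‖ ^ 2))) := by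
    refine Tendsto.mono_left (Continuous.tendsto ?_ 0) nhdsWithin_le_nhds
    fun_prop
  have h3 : ∀ᶠ t : ℝ in 𝓝[>] 0, t⁻¹ • (f (x + t • (z - x)) - f x) ≤
      f z - f x - (1 - t) * (m / 2 * ‖z - x‖ ^ 2) := by
    have : Ioo (0 : ℝ) 1 ∈ 𝓝[>] (0 : ℝ) := Ioo_mem_nhdsGT one_pos
    filter_upwards [this] with t ht
    have h := hf.2 hx hz (sub_nonneg.2 ht.2.le) ht.1.le (sub_add_cancel 1 t)
    have e : (1 - t) • x + t • z = x + t • (z - x) := by module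
    simp only [e, smul_eq_mul, norm_sub_rev x z] at h
    rw [smul_eq_mul, inv_mul_le_iff₀ ht.1]
    linarith
  have := le_of_tendsto_of_tendsto h1 h2 h3
  linarith

theorem ContinuousLinearMap.contDiff_det {E : Type*} [NormedAddCommGroup E] [NormedSpace ℝ E]
    [FiniteDimensional ℝ E] {n : WithTop ℕ∞} : ContDiff ℝ n (fun A : E →L[ℝ] E => A.det) := by
  classical
  let b := Module.finBasis ℝ E
  have h : (fun A : E →L[ℝ] E => A.det) =
      fun A : E →L[ℝ] E => (LinearMap.toMatrix b b (A : E →ₗ[ℝ] E)).det := by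
    funext A
    rw [LinearMap.det_toMatrix]
  rw [h]
  simp only [Matrix.det_apply]
  refine ContDiff.sum fun σ _ => ContDiff.const_smul _ (contDiff_prod fun i _ => ?_)
  simp only [LinearMap.toMatrix_apply]
  exact (LinearMap.toContinuousLinearMap (b.coord (σ i)) ∘L
    ContinuousLinearMap.apply ℝ E (b i)).contDiff

namespace MirroredFlow

variable {d : ℕ}

/-! ### The mirror map as a diffeomorphism onto the whole space -/

section Mirror

variable {X : Set (Euc d)} {φ : Euc d → EReal}

theorem IsMirrorFunction.contDiffAt (hφ : IsMirrorFunction X φ) {x : Euc d}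
    (hx : x ∈ interior X) : ContDiffAt ℝ 3 (realPart φ) x :=
  hφ.contDiff.contDiffAt (isOpen_interior.mem_nhds hx)

theorem IsMirrorFunction.hasGradientAt (hφ : IsMirrorFunction X φ) {x : Euc d}
    (hx : x ∈ interior X) : HasGradientAt (realPart φ) (mirrorMap φ x) x :=
  ((hφ.contDiffAt hx).differentiableAt (by norm_num)).hasGradientAt

theorem IsMirrorFunction.contDiffAt_mirrorMap (hφ : IsMirrorFunction X φ) {x : Euc d}
    (hx : x ∈ interior X) : ContDiffAt ℝ 2 (mirrorMap φ) x :=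
  (InnerProductSpace.toDual ℝ (Euc d)).symm.contDiff.contDiffAt.comp x
    ((hφ.contDiffAt hx).fderiv_right (m := 2) (by norm_num))

theorem IsMirrorFunction.hasFDerivAt_mirrorMap (hφ : IsMirrorFunction X φ) {x : Euc d}
    (hx : x ∈ interior X) : HasFDerivAt (mirrorMap φ) (hessian φ x) x :=
  ((hφ.contDiffAt_mirrorMap hx).differentiableAt (by norm_num)).hasFDerivAt

theorem IsMirrorFunction.gradient_inequality (hφ : IsMirrorFunction X φ) :
    ∃ m : ℝ, 0 < m ∧ ∀ x ∈ interior X, ∀ z ∈ effDom φ,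
      realPart φ x + inner ℝ (mirrorMap φ x) (z - x) + m / 2 * ‖z - x‖ ^ 2 ≤ realPart φ z := by
  obtain ⟨m, hm, hs⟩ := hφ.strongConvex
  refine ⟨m, hm, fun x hx z hz => ?_⟩
  have := hs.le_of_hasFDerivAt (hφ.finite_interior hx) hz (hφ.hasGradientAt hx).hasFDerivAt
  simpa using this

theorem IsMirrorFunction.strongly_monotone (hφ : IsMirrorFunction X φ) :
    ∃ m : ℝ, 0 < m ∧ ∀ x ∈ interior X, ∀ z ∈ interior X,
      m * ‖z - x‖ ^ 2 ≤ inner ℝ (mirrorMap φ z - mirrorMap φ x) (z - x) := by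
  obtain ⟨m, hm, h⟩ := hφ.gradient_inequality
  refine ⟨m, hm, fun x hx z hz => ?_⟩
  have h1 := h x hx z (hφ.finite_interior hz)
  have h2 := h z hz x (hφ.finite_interior hx)
  rw [norm_sub_rev x z, ← neg_sub z x, inner_neg_right] at h2
  rw [inner_sub_left]
  linarith

/-- Strong monotonicity and Cauchy–Schwarz. This bound yields injectivity, nondegeneracy of the
Hessian, closedness of the range and a Lipschitz inverse. -/
theorem IsMirrorFunction.expanding (hφ : IsMirrorFunction X φ) :
    ∃ m : ℝ, 0 < m ∧ ∀ x ∈ interior X, ∀ z ∈ interior X,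
      m * ‖z - x‖ ≤ ‖mirrorMap φ z - mirrorMap φ x‖ := by
  obtain ⟨m, hm, h⟩ := hφ.strongly_monotone
  refine ⟨m, hm, fun x hx z hz => ?_⟩
  rcases (norm_nonneg (z - x)).eq_or_lt with h0 | h0
  · rw [← h0, mul_zero]; positivity
  · have := (h x hx z hz).trans (real_inner_le_norm _ _)
    nlinarith

theorem IsMirrorFunction.injOn (hφ : IsMirrorFunction X φ) :
    InjOn (mirrorMap φ) (interior X) := by
  obtain ⟨m, hm, h⟩ := hφ.expanding
  intro x hx z hz hxz
  have := h x hx z hz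
  rw [hxz, sub_self, norm_zero] at this
  have h0 : ‖z - x‖ ≤ 0 := by nlinarith
  exact (sub_eq_zero.1 (norm_le_zero_iff.1 h0)).symm

/-- Difference quotients inherit the expansion bound, hence so does the derivative in the limit. -/
theorem IsMirrorFunction.hessian_injective (hφ : IsMirrorFunction X φ) {x : Euc d}
    (hx : x ∈ interior X) : Function.Injective (hessian φ x) := by
  obtain ⟨m, hm, h⟩ := hφ.expanding
  rw [injective_iff_map_eq_zero]
  intro v hv
  have h1 := (hφ.hasFDerivAt_mirrorMap hx).hasLineDerivAt v |>.tendsto_slope_zero_right.norm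
  rw [hv, norm_zero] at h1
  have h2 : ∀ᶠ t : ℝ in 𝓝[>] 0, m * ‖v‖ ≤ ‖t⁻¹ • (mirrorMap φ (x + t • v) - mirrorMap φ x)‖ := by
    have : ∀ᶠ t : ℝ in 𝓝[>] 0, x + t • v ∈ interior X := by
      have hc : Continuous fun t : ℝ => x + t • v := by fun_prop
      refine (hc.tendsto 0).eventually_mem ?_ |>.filter_mono nhdsWithin_le_nhds
      simpa using isOpen_interior.mem_nhds hx
    filter_upwards [this, self_mem_nhdsWithin] with t ht ht0
    have h3 := h x hx _ ht
    have ht0 : 0 < t := ht0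
    rw [add_sub_cancel_left, norm_smul, Real.norm_of_nonneg ht0.le] at h3
    rw [norm_smul, norm_inv, Real.norm_of_nonneg ht0.le, le_inv_mul_iff₀ ht0]
    linarith
  have h4 : m * ‖v‖ ≤ 0 := ge_of_tendsto h1 h2
  have : ‖v‖ ≤ 0 := by nlinarith
  exact norm_le_zero_iff.1 this

theorem IsMirrorFunction.exists_hessian_equiv (hφ : IsMirrorFunction X φ) {x : Euc d}
    (hx : x ∈ interior X) : ∃ e : Euc d ≃L[ℝ] Euc d, (e : Euc d →L[ℝ] Euc d) = hessian φ x :=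
  ⟨(LinearEquiv.ofInjectiveEndo (hessian φ x : Euc d →ₗ[ℝ] Euc d)
    (hφ.hessian_injective hx)).toContinuousLinearEquiv, by ext; rfl⟩

theorem IsMirrorFunction.hessian_det_ne_zero (hφ : IsMirrorFunction X φ) {x : Euc d}
    (hx : x ∈ interior X) : (hessian φ x).det ≠ 0 := by
  obtain ⟨e, he⟩ := hφ.exists_hessian_equiv hx
  rw [← he]
  exact (LinearEquiv.isUnit_det' e.toLinearEquiv).ne_zero

/-- Inverse function theorem at each interior point. -/
theorem IsMirrorFunction.isOpen_image (hφ : IsMirrorFunction X φ) :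
    IsOpen (mirrorMap φ '' interior X) := by
  rw [isOpen_iff_mem_nhds]
  rintro _ ⟨x, hx, rfl⟩
  obtain ⟨e, he⟩ := hφ.exists_hessian_equiv hx
  have hs : HasStrictFDerivAt (mirrorMap φ) (e : Euc d →L[ℝ] Euc d) x := by
    rw [he]
    exact (hφ.contDiffAt_mirrorMap hx).hasStrictFDerivAt' (hφ.hasFDerivAt_mirrorMap hx)
      (by norm_num)
  rw [← hs.map_nhds_eq_of_equiv]
  exact image_mem_map (isOpen_interior.mem_nhds hx)

/-- Expansion makes preimages of a convergent sequence Cauchy. Their limit cannot lie on the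
frontier, where steepness would force the image norms to infinity. -/
theorem IsMirrorFunction.isClosed_image (hφ : IsMirrorFunction X φ) :
    IsClosed (mirrorMap φ '' interior X) := by
  obtain ⟨m, hm, h⟩ := hφ.expanding
  refine IsSeqClosed.isClosed fun v y hv hy => ?_
  choose x hx hxv using hv
  have hcau : CauchySeq x := by
    have hvc := hy.cauchySeq
    rw [Metric.cauchySeq_iff] at hvc ⊢
    intro ε hε
    obtain ⟨N, hN⟩ := hvc (m * ε) (by positivity)
    refine ⟨N, fun i hi j hj => ?_⟩
    have h1 := hN i hi j hj
    rw [← hxv, ← hxv, dist_eq_norm] at h1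
    have h2 := (h _ (hx j) _ (hx i)).trans_lt h1
    rw [dist_eq_norm]
    exact lt_of_mul_lt_mul_left h2 hm.le
  obtain ⟨a, ha⟩ := cauchySeq_tendsto_of_complete hcau
  have haX : a ∈ X := hφ.closed.mem_of_tendsto ha (Eventually.of_forall fun n =>
    interior_subset (hx n))
  have hai : a ∈ interior X := by
    by_contra hna
    have hf : a ∈ frontier X := ⟨subset_closure haX, hna⟩
    have h1 : Tendsto (fun n => ‖mirrorMap φ (x n)‖) atTop atTop :=
      (hφ.steep a hf).comp (tendsto_nhdsWithin_iff.2 ⟨ha, Eventually.of_forall hx⟩)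
    simp only [hxv] at h1
    exact not_tendsto_atTop_of_tendsto_nhds hy.norm h1
  refine ⟨a, hai, tendsto_nhds_unique ?_ hy⟩
  have := (hφ.contDiffAt_mirrorMap hai).continuousAt.tendsto.comp ha
  simpa [Function.comp_def, hxv] using this

/-- The range is clopen and nonempty in a connected space. -/
theorem IsMirrorFunction.image_eq_univ (hφ : IsMirrorFunction X φ) :
    mirrorMap φ '' interior X = univ :=
  IsClopen.eq_univ ⟨hφ.isClosed_image, hφ.isOpen_image⟩ (hφ.nonempty_interior.image _)

/-- The mirror map as a partial homeomorphism from the interior of `X` onto `ℝ^d`. -/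
def IsMirrorFunction.homeo (hφ : IsMirrorFunction X φ) :
    OpenPartialHomeomorph (Euc d) (Euc d) where
  toFun := mirrorMap φ
  invFun := Function.invFunOn (mirrorMap φ) (interior X)
  source := interior X
  target := univ
  map_source' _ _ := mem_univ _
  map_target' y _ := Function.invFunOn_mem (by
    have : y ∈ mirrorMap φ '' interior X := by rw [hφ.image_eq_univ]; trivial
    simpa using this)
  left_inv' _ hx := hφ.injOn.leftInvOn_invFunOn hx
  right_inv' y _ := Function.invFunOn_eq (by
    have : y ∈ mirrorMap φ '' interior X := by rw [hφ.image_eq_univ]; trivial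
    simpa using this)
  open_source := isOpen_interior
  open_target := isOpen_univ
  continuousOn_toFun _ hx := (hφ.contDiffAt_mirrorMap hx).continuousAt.continuousWithinAt
  continuousOn_invFun := by
    obtain ⟨m, hm, h⟩ := hφ.expanding
    have hex : ∀ y, ∃ x ∈ interior X, mirrorMap φ x = y := fun y => by
      have : y ∈ mirrorMap φ '' interior X := by rw [hφ.image_eq_univ]; trivial
      simpa using this
    refine (LipschitzWith.of_dist_le_mul (K := ⟨m⁻¹, by positivity⟩)
      fun y z => ?_).continuous.continuousOn
    have h1 := h _ (Function.invFunOn_mem (hex z)) _ (Function.invFunOn_mem (hex y))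
    rw [Function.invFunOn_eq (hex z), Function.invFunOn_eq (hex y)] at h1
    rw [dist_eq_norm, dist_eq_norm]
    change _ ≤ m⁻¹ * _
    rwa [le_inv_mul_iff₀ hm]

theorem IsMirrorFunction.homeo_symm_mem (hφ : IsMirrorFunction X φ) (y : Euc d) :
    hφ.homeo.symm y ∈ interior X := hφ.homeo.map_target (mem_univ y)

theorem IsMirrorFunction.mirrorMap_homeo_symm (hφ : IsMirrorFunction X φ) (y : Euc d) :
    mirrorMap φ (hφ.homeo.symm y) = y := hφ.homeo.right_inv (mem_univ y)

theorem IsMirrorFunction.contDiff_homeo_symm (hφ : IsMirrorFunction X φ) :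
    ContDiff ℝ 2 hφ.homeo.symm := by
  rw [contDiff_iff_contDiffAt]
  intro y
  have hx := hφ.homeo_symm_mem y
  obtain ⟨e, he⟩ := hφ.exists_hessian_equiv hx
  have hd : HasFDerivAt hφ.homeo (e : Euc d →L[ℝ] Euc d) (hφ.homeo.symm y) := by
    rw [he]
    exact hφ.hasFDerivAt_mirrorMap hx
  exact hφ.homeo.contDiffAt_symm (mem_univ y) hd (hφ.contDiffAt_mirrorMap hx)

/-- By the gradient inequality, the supremum is attained at the point whose mirror image is `y`. -/
theorem IsMirrorFunction.conjugate_eq (hφ : IsMirrorFunction X φ) (y : Euc d) :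
    conjugate X φ y = inner ℝ (hφ.homeo.symm y) y - realPart φ (hφ.homeo.symm y) := by
  obtain ⟨m, hm, h⟩ := hφ.gradient_inequality
  set x := hφ.homeo.symm y with hxdef
  have hx := hφ.homeo_symm_mem y
  have hy := hφ.mirrorMap_homeo_symm y
  rw [← hxdef] at hx hy
  have hcoe : ∀ z ∈ effDom φ, φ z = (realPart φ z : EReal) := fun z hz =>
    (EReal.coe_toReal hz (hφ.ne_bot z)).symm
  have hsup : (⨆ z ∈ X, ((inner ℝ z y : ℝ) : EReal) - φ z) =
      ((inner ℝ x y - realPart φ x : ℝ) : EReal) := by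
    apply le_antisymm
    · refine iSup₂_le fun z _ => ?_
      by_cases hz : φ z = ⊤
      · rw [hz]; simp
      · rw [hcoe z hz, ← EReal.coe_sub, EReal.coe_le_coe_iff]
        have h1 := h x hx z hz
        rw [hy, inner_sub_right, real_inner_comm, real_inner_comm x y] at h1
        have : 0 ≤ m / 2 * ‖z - x‖ ^ 2 := by positivity
        linarith
    · refine le_iSup₂_of_le x (interior_subset hx) ?_
      rw [hcoe x (hφ.finite_interior hx), EReal.coe_sub]
  rw [conjugate, hsup, EReal.toReal_coe]

/-- Envelope argument: when the formula for the conjugate is differentiated, the two terms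
containing the derivative of the inverse cancel, because the mirror map sends the maximizer to `y`.
-/
theorem IsMirrorFunction.dualMap_eq (hφ : IsMirrorFunction X φ) :
    dualMap X φ = hφ.homeo.symm := by
  funext y
  have hG : HasFDerivAt hφ.homeo.symm (fderiv ℝ hφ.homeo.symm y) y :=
    (hφ.contDiff_homeo_symm.differentiable (by norm_num) y).hasFDerivAt
  have h1 := hG.inner ℝ (hasFDerivAt_id y)
  have h2 := (hφ.hasGradientAt (hφ.homeo_symm_mem y)).hasFDerivAt.comp y hG
  have h3 := h1.sub h2
  refine HasGradientAt.gradient ?_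
  rw [hasGradientAt_iff_hasFDerivAt]
  have h4 : conjugate X φ = fun y => inner ℝ (hφ.homeo.symm y) y - realPart φ (hφ.homeo.symm y) :=
    funext hφ.conjugate_eq
  rw [h4]
  refine h3.congr_fderiv ?_
  ext v
  simp [hφ.mirrorMap_homeo_symm, real_inner_comm]

theorem IsMirrorFunction.dualMap_mem (hφ : IsMirrorFunction X φ) (y : Euc d) :
    dualMap X φ y ∈ interior X := hφ.dualMap_eq ▸ hφ.homeo_symm_mem y

theorem IsMirrorFunction.mirrorMap_dualMap (hφ : IsMirrorFunction X φ) (y : Euc d) :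
    mirrorMap φ (dualMap X φ y) = y := hφ.dualMap_eq ▸ hφ.mirrorMap_homeo_symm y

theorem IsMirrorFunction.dualMap_mirrorMap (hφ : IsMirrorFunction X φ) {x : Euc d}
    (hx : x ∈ interior X) : dualMap X φ (mirrorMap φ x) = x :=
  hφ.dualMap_eq ▸ hφ.homeo.left_inv hx

theorem IsMirrorFunction.contDiff_dualMap (hφ : IsMirrorFunction X φ) :
    ContDiff ℝ 2 (dualMap X φ) := hφ.dualMap_eq ▸ hφ.contDiff_homeo_symm

/-- The order is `1` because `φ` is only `C³`, so its Hessian is only `C¹`. -/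
theorem IsMirrorFunction.contDiff_mirroredPotential (hφ : IsMirrorFunction X φ)
    {V : Euc d → ℝ} (hV : ContDiffOn ℝ ∞ V (interior X)) :
    ContDiff ℝ 1 (mirroredPotential X φ V) := by
  rw [contDiff_iff_contDiffAt]
  intro y
  have hx := hφ.dualMap_mem y
  have hG : ContDiffAt ℝ 1 (dualMap X φ) y :=
    (hφ.contDiff_dualMap.of_le (by norm_num)).contDiffAt
  have hV' : ContDiffAt ℝ 1 V (dualMap X φ y) :=
    (hV.contDiffAt (isOpen_interior.mem_nhds hx)).of_le (by exact_mod_cast le_top)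
  have hH : ContDiffAt ℝ 1 (hessian φ) (dualMap X φ y) :=
    (hφ.contDiffAt_mirrorMap hx).fderiv_right (by norm_num)
  exact (hV'.comp y hG).add (((ContinuousLinearMap.contDiff_det.contDiffAt.comp _ hH).comp y
    hG).log (hφ.hessian_det_ne_zero hx))

end Mirror

/-! ### The mirrored target and invariance of relative entropy -/

section Density

variable {X : Set (Euc d)} {φ : Euc d → EReal} {V : Euc d → ℝ} {π : Measure (Euc d)}

open Classical in
/-- A measurable extension of the mirror map. -/
def measurableMirrorMap (X : Set (Euc d)) (φ : Euc d → EReal) : Euc d → Euc d :=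
  (interior X).piecewise (mirrorMap φ) 0

theorem measurableMirrorMap_of_mem {x : Euc d} (hx : x ∈ interior X) :
    measurableMirrorMap X φ x = mirrorMap φ x := by
  classical exact piecewise_eq_of_mem _ _ _ hx

theorem IsMirrorFunction.measurable_measurableMirrorMap (hφ : IsMirrorFunction X φ) :
    Measurable (measurableMirrorMap X φ) := by
  classical
  exact ContinuousOn.measurable_piecewise
    (fun _ hx => (hφ.contDiffAt_mirrorMap hx).continuousAt.continuousWithinAt)
    continuousOn_const isOpen_interior.measurableSet

/-- The boundary of a convex set is Lebesgue null. -/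
theorem IsMirrorFunction.restrict_interior (hφ : IsMirrorFunction X φ) :
    volume.restrict X = volume.restrict (interior X) := by
  refine (Measure.restrict_congr_set (ae_eq_set.2 ⟨?_, ?_⟩)).symm
  · rw [sdiff_eq_empty.2 interior_subset, measure_empty]
  · rw [← hφ.closed.frontier_eq]
    exact hφ.convex.addHaar_frontier volume

theorem IsTarget.ae_mem_interior (hφ : IsMirrorFunction X φ) (hπ : IsTarget X V π) :
    ∀ᵐ x ∂π, x ∈ interior X := by
  rw [hπ.density, hφ.restrict_interior]
  refine Measure.ae_smul_measure ?_ _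
  exact (withDensity_absolutelyContinuous _ _).ae_le
    (ae_restrict_mem isOpen_interior.measurableSet)

/-- Nothing is known about the gradient of `φ` off the interior; this replaces it by a globally
measurable map, as required to compute push-forwards. -/
theorem IsTarget.mirrored_eq_map (hφ : IsMirrorFunction X φ) (hπ : IsTarget X V π) :
    mirrored φ π = π.map (measurableMirrorMap X φ) := by
  refine Measure.map_congr ?_
  filter_upwards [hπ.ae_mem_interior hφ] with x hx
  exact (measurableMirrorMap_of_mem hx).symm

theorem IsTarget.isProbabilityMeasure_mirrored (hφ : IsMirrorFunction X φ)
    (hπ : IsTarget X V π) : IsProbabilityMeasure (mirrored φ π) := by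
  have := hπ.prob
  rw [hπ.mirrored_eq_map hφ]
  exact Measure.isProbabilityMeasure_map hφ.measurable_measurableMirrorMap.aemeasurable

theorem IsTarget.map_dualMap_mirrored (hφ : IsMirrorFunction X φ) (hπ : IsTarget X V π) :
    (mirrored φ π).map (dualMap X φ) = π := by
  rw [hπ.mirrored_eq_map hφ, Measure.map_map hφ.contDiff_dualMap.continuous.measurable
    hφ.measurable_measurableMirrorMap]
  refine (Measure.map_congr ?_).trans Measure.map_id
  filter_upwards [hπ.ae_mem_interior hφ] with x hx
  simp [measurableMirrorMap_of_mem hx, hφ.dualMap_mirrorMap hx]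

theorem IsMirrorFunction.map_measurableMirrorMap_map_dualMap (hφ : IsMirrorFunction X φ)
    (η : Measure (Euc d)) : (η.map (dualMap X φ)).map (measurableMirrorMap X φ) = η := by
  rw [Measure.map_map hφ.measurable_measurableMirrorMap hφ.contDiff_dualMap.continuous.measurable]
  have : measurableMirrorMap X φ ∘ dualMap X φ = id := by
    funext y
    simp [measurableMirrorMap_of_mem (hφ.dualMap_mem y), hφ.mirrorMap_dualMap]
  rw [this, Measure.map_id]

/-- Data processing in both directions: each of the two maps undoes the other on the measures
involved. -/
theorem IsTarget.klDiv_map_dualMap (hφ : IsMirrorFunction X φ) (hπ : IsTarget X V π)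
    (η : Measure (Euc d)) [IsFiniteMeasure η] :
    InformationTheory.klDiv (η.map (dualMap X φ)) π =
      InformationTheory.klDiv η (mirrored φ π) := by
  have := hπ.prob
  have := hπ.isProbabilityMeasure_mirrored hφ
  apply le_antisymm
  · conv_lhs => rw [← hπ.map_dualMap_mirrored hφ]
    exact InformationTheory.klDiv_map_le _ _ hφ.contDiff_dualMap.continuous.measurable
  · conv_lhs => rw [← hφ.map_measurableMirrorMap_map_dualMap η, hπ.mirrored_eq_map hφ]
    exact InformationTheory.klDiv_map_le _ _ hφ.measurable_measurableMirrorMap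

/-- The mirrored target has density proportional to `e^{-W}`. -/
theorem IsTarget.exists_density_mirrored (hφ : IsMirrorFunction X φ) (hπ : IsTarget X V π) :
    ∃ c : ℝ, 0 < c ∧ mirrored φ π = volume.withDensity
      (fun y => ENNReal.ofReal (c * Real.exp (-mirroredPotential X φ V y))) := by
  have := hπ.prob
  set Z := ∫⁻ x in X, ENNReal.ofReal (Real.exp (-V x)) with hZ
  have huniv : π univ = 1 := measure_univ
  rw [hπ.density, Measure.smul_apply, withDensity_apply _ MeasurableSet.univ, Measure.restrict_univ,
    ← hZ, smul_eq_mul] at huniv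
  have hZ0 : Z ≠ 0 := by rintro h; simp [h] at huniv
  have hZt : Z ≠ ⊤ := by rintro h; simp [h] at huniv
  have hc : 0 < Z⁻¹.toReal :=
    ENNReal.toReal_pos (ENNReal.inv_ne_zero.2 hZt) (ENNReal.inv_ne_top.2 hZ0)
  refine ⟨Z⁻¹.toReal, hc, ?_⟩
  have hg := hφ.measurable_measurableMirrorMap
  ext A hA
  have hm : Measurable fun y => ENNReal.ofReal (Real.exp (-mirroredPotential X φ V y)) :=
    (hφ.contDiff_mirroredPotential hπ.smooth).continuous.measurable.neg.exp.ennreal_ofReal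
  rw [hπ.mirrored_eq_map hφ, Measure.map_apply hg hA, withDensity_apply _ hA, hπ.density,
    ← hZ, Measure.smul_apply, withDensity_apply _ (hg hA), hφ.restrict_interior,
    Measure.restrict_restrict (hg hA), smul_eq_mul]
  simp_rw [ENNReal.ofReal_mul hc.le]
  rw [lintegral_const_mul _ hm, ENNReal.ofReal_toReal (ENNReal.inv_ne_top.2 hZ0)]
  congr 1
  set s := measurableMirrorMap X φ ⁻¹' A ∩ interior X with hs
  have hsm : MeasurableSet s := (hg hA).inter isOpen_interior.measurableSet
  have himg : mirrorMap φ '' s = A := by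
    ext y
    constructor
    · rintro ⟨x, ⟨hxA, hx⟩, rfl⟩
      rwa [mem_preimage, measurableMirrorMap_of_mem hx] at hxA
    · intro hy
      refine ⟨dualMap X φ y, ⟨?_, hφ.dualMap_mem y⟩, hφ.mirrorMap_dualMap y⟩
      rwa [mem_preimage, measurableMirrorMap_of_mem (hφ.dualMap_mem y), hφ.mirrorMap_dualMap]
  -- Change of variables `y = ∇φ(x)`; the Jacobian will cancel the log-determinant term of `W`.
  rw [← himg, lintegral_image_eq_lintegral_abs_det_fderiv_mul volume hsm
    (fun x hx => (hφ.hasFDerivAt_mirrorMap hx.2).hasFDerivWithinAt)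
    (hφ.injOn.mono inter_subset_right)]
  refine setLIntegral_congr_fun hsm fun x hx => ?_
  have hd := hφ.hessian_det_ne_zero hx.2
  simp only [mirroredPotential, hφ.dualMap_mirrorMap hx.2]
  -- `exp (log det)` is the absolute value of the determinant, which is the Jacobian itself; only
  -- its nonvanishing is needed, not its sign.
  rw [← ENNReal.ofReal_mul (abs_nonneg _), neg_add, Real.exp_add, Real.exp_neg (Real.log _),
    Real.exp_log_eq_abs hd]
  congr 1
  have := abs_ne_zero.2 hd
  field_simp

end Density

/-! ### Divergence and integration by parts -/

section Calculus

theorem continuous_divergence {F : Euc d → Euc d} (hF : ContDiff ℝ 1 F) :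
    Continuous (divergence F) := by
  unfold divergence
  have := hF.continuous_fderiv (by norm_num)
  fun_prop

theorem divergence_smul {a : Euc d → ℝ} {F : Euc d → Euc d} {y : Euc d}
    (ha : DifferentiableAt ℝ a y) (hF : DifferentiableAt ℝ F y) :
    divergence (fun z => a z • F z) y = a y * divergence F y + fderiv ℝ a y (F y) := by
  have h1 : fderiv ℝ a y (F y) = ∑ i, F y i * fderiv ℝ a y (EuclideanSpace.single i 1) := by
    conv_lhs => rw [← (EuclideanSpace.basisFun (Fin d) ℝ).sum_repr (F y)]
    simp [map_sum]
  rw [h1]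
  simp only [divergence, fderiv_fun_smul ha hF, Finset.mul_sum, ← Finset.sum_add_distrib]
  refine Finset.sum_congr rfl fun i _ => ?_
  simp [mul_comm]

theorem integral_divergence_eq_zero {F : Euc d → Euc d} (hF : ContDiff ℝ 1 F)
    (hc : HasCompactSupport F) : ∫ y, divergence F y = 0 := by
  have hcf := hF.continuous_fderiv (by norm_num)
  have hint : ∀ i : Fin d, Integrable
      (fun y => fderiv ℝ F y (EuclideanSpace.single i 1)) := fun i =>
    (by fun_prop : Continuous fun y => fderiv ℝ F y (EuclideanSpace.single i 1))
      |>.integrable_of_hasCompactSupport ((hc.fderiv (𝕜 := ℝ)).comp_left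
        (g := fun A : Euc d →L[ℝ] Euc d => A (EuclideanSpace.single i 1)) rfl)
  have hzero : ∀ i : Fin d, ∫ y, fderiv ℝ F y (EuclideanSpace.single i 1) = 0 := fun i => by
    -- Integration by parts against the constant `1`, whose derivative vanishes.
    have := integral_smul_fderiv_eq_neg_fderiv_smul_of_integrable (μ := volume)
      (f := fun _ : Euc d => (1 : ℝ)) (g := F) (v := EuclideanSpace.single i 1) (by simp)
      (by simpa using hint i)
      (by simpa using hF.continuous.integrable_of_hasCompactSupport hc)
      (fun _ _ => differentiableAt_const _) (fun y _ => hF.differentiable (by norm_num) y)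
    simpa using this
  simp only [divergence]
  have hproj : ∀ i : Fin d, Integrable
      (fun y => (fderiv ℝ F y (EuclideanSpace.single i 1)) i) := fun i =>
    (EuclideanSpace.proj i : Euc d →L[ℝ] ℝ).integrable_comp (hint i)
  rw [integral_finsetSum _ fun i _ => hproj i]
  refine Finset.sum_eq_zero fun i _ => ?_
  have := (EuclideanSpace.proj i : Euc d →L[ℝ] ℝ).integral_comp_comm (hint i)
  rw [hzero i, map_zero] at this
  exact this

theorem integral_mul_divergence {χ : Euc d → ℝ} {F : Euc d → Euc d} (hχ : ContDiff ℝ 1 χ)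
    (hF : ContDiff ℝ 1 F) (hc : HasCompactSupport χ ∨ HasCompactSupport F) :
    ∫ y, χ y * divergence F y = -∫ y, fderiv ℝ χ y (F y) := by
  have hcont : Continuous fun y => fderiv ℝ χ y (F y) :=
    (hχ.continuous_fderiv (by norm_num)).clm_apply hF.continuous
  have hcs : HasCompactSupport fun z => χ z • F z := by
    rcases hc with hc | hc
    · exact HasCompactSupport.smul_right (f := χ) (f' := F) hc
    · exact HasCompactSupport.smul_left (f := χ) (f' := F) hc
  have h1 : HasCompactSupport fun y => χ y * divergence F y := by
    rcases hc with hc | hc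
    · exact hc.mul_right
    · refine HasCompactSupport.mul_left ?_
      exact (hc.fderiv (𝕜 := ℝ)).comp_left (g := fun A : Euc d →L[ℝ] Euc d =>
        ∑ i : Fin d, (A (EuclideanSpace.single i 1)) i) (by simp)
  have h2 : HasCompactSupport fun y => fderiv ℝ χ y (F y) := by
    rcases hc with hc | hc
    · refine (hc.fderiv (𝕜 := ℝ)).mono fun y hy => ?_
      contrapose! hy
      simp only [Function.mem_support, not_not] at hy ⊢
      simp [hy]
    · refine hc.mono fun y hy => ?_
      contrapose! hy
      simp only [Function.mem_support, not_not] at hy ⊢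
      simp [hy]
  have h := integral_divergence_eq_zero (F := fun z => χ z • F z) (hχ.smul hF) hcs
  have he : divergence (fun z => χ z • F z) =
      fun y => χ y * divergence F y + fderiv ℝ χ y (F y) := by
    funext y
    exact divergence_smul (hχ.differentiable (by norm_num) y) (hF.differentiable (by norm_num) y)
  have i1 : Integrable fun y => χ y * divergence F y :=
    (hχ.continuous.mul (continuous_divergence hF)).integrable_of_hasCompactSupport h1
  simp only [he] at h
  rw [integral_add i1 (hcont.integrable_of_hasCompactSupport h2)] at h
  linarith

theorem contDiff_gradient {f : Euc d → ℝ} {n m : WithTop ℕ∞} (hf : ContDiff ℝ m f)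
    (hnm : n + 1 ≤ m) : ContDiff ℝ n (gradient f) :=
  (InnerProductSpace.toDual ℝ (Euc d)).symm.contDiff.comp (hf.fderiv_right hnm)

theorem inner_gradient {f : Euc d → ℝ} (y v : Euc d) :
    inner ℝ (gradient f y) v = fderiv ℝ f y v := by
  rw [gradient, InnerProductSpace.toDual_symm_apply]

theorem laplacian_eq_divergence {f : Euc d → ℝ} (hf : ContDiff ℝ 2 f) (y : Euc d) :
    Laplacian.laplacian f y = divergence (gradient f) y := by
  rw [InnerProductSpace.laplacian_eq_iteratedFDeriv_orthonormalBasis f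
    (EuclideanSpace.basisFun (Fin d) ℝ)]
  simp only [divergence]
  refine Finset.sum_congr rfl fun i _ => ?_
  have h1 : DifferentiableAt ℝ (fderiv ℝ f) y :=
    (hf.fderiv_right (m := 1) (by norm_num)).differentiable (by norm_num) y
  have h2 : HasFDerivAt (gradient f) (fderiv ℝ (gradient f) y) y :=
    ((contDiff_gradient hf (n := 1) (by norm_num)).differentiable (by norm_num) y).hasFDerivAt
  have h3 := (h2.inner ℝ (hasFDerivAt_const (EuclideanSpace.single i (1 : ℝ)) y)).fderiv
  simp only [inner_gradient] at h3
  have h4 := (h1.hasFDerivAt.clm_apply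
    (hasFDerivAt_const (EuclideanSpace.single i (1 : ℝ)) y)).fderiv
  have h5 := DFunLike.congr_fun (h4.symm.trans h3) (EuclideanSpace.single i (1 : ℝ))
  rw [iteratedFDeriv_two_apply]
  simpa [EuclideanSpace.inner_single_right] using h5

end Calculus

/-! ### The Langevin operator and its weak formulation -/

section Langevin

variable {W : Euc d → ℝ} {c : ℝ}

theorem continuous_langevin (hW : ContDiff ℝ 1 W) {f : Euc d → ℝ} (hf : ContDiff ℝ 2 f) :
    Continuous (langevin W f) := by
  have h1 := (contDiff_gradient hW (n := 0) (by norm_num)).continuous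
  have h2 := contDiff_gradient hf (n := 1) (by norm_num)
  have h3 : langevin W f = fun y => divergence (gradient f) y -
      inner ℝ (gradient W y) (gradient f y) := by
    funext y
    rw [langevin, laplacian_eq_divergence hf]
  rw [h3]
  exact (continuous_divergence h2).sub (h1.inner h2.continuous)

theorem hasCompactSupport_langevin {f : Euc d → ℝ} (hf : HasCompactSupport f) :
    HasCompactSupport (langevin W f) := by
  refine HasCompactSupport.intro hf fun y hy => ?_
  have h : f =ᶠ[𝓝 y] fun _ => 0 := notMem_tsupport_iff_eventuallyEq.1 hy
  have h2 : gradient f y = 0 := by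
    rw [gradient, h.fderiv_eq]
    simp
  rw [langevin, (InnerProductSpace.laplacian_congr_nhds h).eq_of_nhds, h2]
  simp

/-- Divergence form of the operator: differentiating the Gibbs weight produces the drift term. -/
theorem divergence_gibbs_smul_gradient (hW : ContDiff ℝ 1 W) {f : Euc d → ℝ}
    (hf : ContDiff ℝ 2 f) (y : Euc d) :
    divergence (fun z => (c * Real.exp (-W z)) • gradient f z) y =
      c * Real.exp (-W y) * langevin W f y := by
  have hp : HasFDerivAt (fun z => c * Real.exp (-W z))
      (c • Real.exp (-W y) • -fderiv ℝ W y) y :=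
    (((hW.differentiable (by norm_num) y).hasFDerivAt.neg).exp).const_mul c
  rw [divergence_smul hp.differentiableAt
    ((contDiff_gradient hf (n := 1) (by norm_num)).differentiable (by norm_num) y), hp.fderiv,
    langevin, laplacian_eq_divergence hf, inner_gradient]
  simp
  ring

theorem contDiff_gibbs (hW : ContDiff ℝ 1 W) : ContDiff ℝ 1 fun z => c * Real.exp (-W z) :=
  contDiff_const.mul hW.neg.exp

/-- Symmetry of the Langevin operator, one of the functions being compactly supported. -/
theorem integral_mul_langevin_comm (hW : ContDiff ℝ 1 W) {f g : Euc d → ℝ}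
    (hf : ContDiff ℝ 2 f) (hg : ContDiff ℝ 2 g) (hgc : HasCompactSupport g) :
    ∫ y, f y * (c * Real.exp (-W y) * langevin W g y) =
      ∫ y, g y * (c * Real.exp (-W y) * langevin W f y) := by
  simp_rw [← divergence_gibbs_smul_gradient hW hf, ← divergence_gibbs_smul_gradient hW hg]
  have hgrad : HasCompactSupport (gradient g) :=
    (hgc.fderiv (𝕜 := ℝ)).comp_left (map_zero _)
  rw [integral_mul_divergence (F := fun z => (c * Real.exp (-W z)) • gradient g z)
      (hf.of_le (by norm_num)) ((contDiff_gibbs hW).smul (contDiff_gradient hg (by norm_num)))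
      (Or.inr (HasCompactSupport.smul_left (f := fun z => c * Real.exp (-W z)) hgrad)),
    integral_mul_divergence (F := fun z => (c * Real.exp (-W z)) • gradient f z)
      (hg.of_le (by norm_num)) ((contDiff_gibbs hW).smul (contDiff_gradient hf (by norm_num)))
      (Or.inl hgc)]
  congr 1
  refine integral_congr_ae (Eventually.of_forall fun y => ?_)
  simp only [map_smul, ← inner_gradient]
  rw [real_inner_comm]

theorem integral_gibbs (hW : ContDiff ℝ 1 W) (hc : 0 < c) (f : Euc d → ℝ) :
    ∫ y, f y ∂(volume.withDensity fun y => ENNReal.ofReal (c * Real.exp (-W y))) =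
      ∫ y, c * Real.exp (-W y) * f y := by
  have hpos : ∀ y, 0 ≤ c * Real.exp (-W y) := fun y => by positivity
  rw [integral_withDensity_eq_integral_toReal_smul
    (contDiff_gibbs hW).continuous.measurable.ennreal_ofReal (by simp)]
  simp [ENNReal.toReal_ofReal, hpos]

/-- Elements of the generator satisfy the Langevin equation in the sense of distributions. -/
theorem integral_mul_langevin_of_mem_generator (hW : ContDiff ℝ 1 W) (hc : 0 < c)
    {ν : Measure (Euc d)} [IsProbabilityMeasure ν]
    (hν : ν = volume.withDensity fun y => ENNReal.ofReal (c * Real.exp (-W y)))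
    {x : Lp ℝ 2 ν × Lp ℝ 2 ν} (hx : x ∈ generator W ν)
    {ψ : Euc d → ℝ} (hψ : ContDiff ℝ ∞ ψ) (hψc : HasCompactSupport ψ) :
    ∫ y, x.1 y * langevin W ψ y ∂ν = ∫ y, x.2 y * ψ y ∂ν := by
  have two : (2 : WithTop ℕ∞) ≤ ∞ := WithTop.coe_le_coe.2 (le_top : (2 : ℕ∞) ≤ ⊤)
  have hψ2 := hψ.of_le two
  have hL : MemLp (langevin W ψ) 2 ν :=
    (continuous_langevin hW hψ2).memLp_of_hasCompactSupport (hasCompactSupport_langevin hψc)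
  have hψL : MemLp ψ 2 ν := hψ.continuous.memLp_of_hasCompactSupport hψc
  have key : ∀ (g : Lp ℝ 2 ν) (f : Euc d → ℝ) (hf : MemLp f 2 ν),
      ∫ y, g y * f y ∂ν = inner ℝ (hf.toLp f) g := fun g f hf => by
    rw [L2.inner_def]
    refine integral_congr_ae ?_
    filter_upwards [hf.coeFn_toLp] with y hy
    simp [hy]
  rw [key _ _ hL, key _ _ hψL]
  -- The identity is a closed condition on pairs in `L² × L²`, so it need only be checked on the
  -- core, where it is the symmetry of the operator.
  have hcl : IsClosed {x : Lp ℝ 2 ν × Lp ℝ 2 ν |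
      inner ℝ (hL.toLp _) x.1 = inner ℝ (hψL.toLp _) x.2} :=
    isClosed_eq (by fun_prop) (by fun_prop)
  refine closure_minimal ?_ hcl hx
  rintro z ⟨f, hf, hfc, h1, h2⟩
  change inner ℝ (hL.toLp _) z.1 = inner ℝ (hψL.toLp _) z.2
  rw [← key, ← key]
  have e1 : ∫ y, z.1 y * langevin W ψ y ∂ν = ∫ y, f y * langevin W ψ y ∂ν :=
    integral_congr_ae (by filter_upwards [h1] with y hy; rw [hy])
  have e2 : ∫ y, z.2 y * ψ y ∂ν = ∫ y, langevin W f y * ψ y ∂ν :=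
    integral_congr_ae (by filter_upwards [h2] with y hy; rw [hy])
  rw [e1, e2, hν, integral_gibbs hW hc, integral_gibbs hW hc]
  have := integral_mul_langevin_comm (c := c) hW (hf.of_le two) hψ2 hψc
  convert this using 3 <;> ring

/-- A `C²` function in the domain of the generator satisfies the Langevin equation pointwise. -/
theorem divergence_eq_of_mem_generator (hW : ContDiff ℝ 1 W) (hc : 0 < c)
    {ν : Measure (Euc d)} [IsProbabilityMeasure ν]
    (hν : ν = volume.withDensity fun y => ENNReal.ofReal (c * Real.exp (-W y)))
    {g h : Lp ℝ 2 ν} (hgh : (g, h) ∈ generator W ν) {u r : Euc d → ℝ} (hu : ContDiff ℝ 2 u)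
    (hgu : g =ᵐ[ν] u) (hr : Continuous r)
    (hhr : h =ᵐ[ν] fun y => r y / (c * Real.exp (-W y))) (y : Euc d) :
    divergence (fun z => (c * Real.exp (-W z)) • gradient u z) y = r y := by
  have hF : ContDiff ℝ 1 fun z => (c * Real.exp (-W z)) • gradient u z :=
    (contDiff_gibbs hW).smul (contDiff_gradient hu (by norm_num))
  have hD := continuous_divergence hF
  -- Both sides are continuous and Lebesgue measure charges every nonempty open set, so equality
  -- almost everywhere suffices; that follows by testing against smooth compactly supported
  -- functions.
  suffices hz : (fun y => divergence (fun z => (c * Real.exp (-W z)) • gradient u z) y - r y)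
      =ᵐ[volume] fun _ => 0 by
    have := (Continuous.ae_eq_iff_eq volume (hD.sub hr) continuous_const).1 hz
    exact sub_eq_zero.1 (congrFun this y)
  refine ae_eq_zero_of_integral_contDiff_smul_eq_zero (hD.sub hr).locallyIntegrable
    fun ψ hψ hψc => ?_
  have two : (2 : WithTop ℕ∞) ≤ ∞ := WithTop.coe_le_coe.2 (le_top : (2 : ℕ∞) ≤ ⊤)
  have h1 := integral_mul_langevin_of_mem_generator hW hc hν hgh hψ hψc
  have e1 : ∫ y, g y * langevin W ψ y ∂ν = ∫ y, u y * langevin W ψ y ∂ν :=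
    integral_congr_ae (by filter_upwards [hgu] with y hy; rw [hy])
  have e2 : ∫ y, h y * ψ y ∂ν = ∫ y, r y / (c * Real.exp (-W y)) * ψ y ∂ν :=
    integral_congr_ae (by filter_upwards [hhr] with y hy; rw [hy])
  rw [e1, e2, hν, integral_gibbs hW hc, integral_gibbs hW hc] at h1
  have h2 := integral_mul_langevin_comm (c := c) hW hu (hψ.of_le two) hψc
  have e3 : ∀ y, c * Real.exp (-W y) * (u y * langevin W ψ y) =
      u y * (c * Real.exp (-W y) * langevin W ψ y) := fun y => by ring
  have e4 : ∀ y, c * Real.exp (-W y) * (r y / (c * Real.exp (-W y)) * ψ y) = ψ y * r y :=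
    fun y => by
      have : c * Real.exp (-W y) ≠ 0 := by positivity
      field_simp
  simp_rw [e3, e4] at h1
  rw [h1] at h2
  simp_rw [← divergence_gibbs_smul_gradient hW hu] at h2
  simp_rw [smul_eq_mul, mul_sub]
  rw [integral_sub, h2, sub_self]
  · exact (hψ.continuous.mul hD).integrable_of_hasCompactSupport hψc.mul_right
  · exact (hψ.continuous.mul hr).integrable_of_hasCompactSupport hψc.mul_right

end Langevin

/-! ### Elementary estimates for the conserved integrand -/

section MixRatio

/-- The integrand `q² / ((1 - b) q + b p)` of `1 + χ²(q ‖ (1 - b) q + b p)`. -/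
def mixRatio (b q p : ℝ) : ℝ := q ^ 2 / ((1 - b) * q + b * p)

variable {b b' q q' p β : ℝ}

theorem mix_pos (hb : 0 < b) (hb1 : b < 1) (hq : 0 ≤ q) (hp : 0 < p) :
    0 < (1 - b) * q + b * p := by
  have : 0 ≤ (1 - b) * q := mul_nonneg (by linarith) hq
  have : 0 < b * p := by positivity
  linarith

theorem mixRatio_nonneg (hb : 0 < b) (hb1 : b < 1) (hq : 0 ≤ q) (hp : 0 < p) :
    0 ≤ mixRatio b q p := div_nonneg (sq_nonneg q) (mix_pos hb hb1 hq hp).le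

/-- Drop `b p` from the denominator. This domination by `q` provides integrability of both the
quantity and its flux. -/
theorem mixRatio_le (hb : 0 < b) (hb1 : b < 1) (hq : 0 ≤ q) (hp : 0 < p) :
    mixRatio b q p ≤ (1 - b)⁻¹ * q := by
  rw [mixRatio, div_le_iff₀ (mix_pos hb hb1 hq hp)]
  have h1 : (1 - b) ≠ 0 := by linarith
  have h2 : 0 ≤ (1 - b)⁻¹ * q * (b * p) := by
    have : 0 < 1 - b := by linarith
    positivity
  calc q ^ 2 = (1 - b)⁻¹ * q * ((1 - b) * q) := by field_simp
    _ ≤ _ := by rw [mul_add]; linarith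

/-- A Lipschitz bound uniform in `p`: it converts `L¹` convergence of `q_t` into convergence of the
integrals at time `0`. -/
theorem abs_mixRatio_sub_le_left (hb : 0 < b) (hb1 : b < 1) (hq : 0 ≤ q) (hq' : 0 ≤ q')
    (hp : 0 < p) : |mixRatio b q p - mixRatio b q' p| ≤ (1 - b)⁻¹ * |q - q'| := by
  have hm := mix_pos hb hb1 hq hp
  have hm' := mix_pos hb hb1 hq' hp
  have h1 : 0 < 1 - b := by linarith
  have e : mixRatio b q p - mixRatio b q' p =
      ((1 - b) * (q * q') + b * p * (q + q')) /
        (((1 - b) * q + b * p) * ((1 - b) * q' + b * p)) * (q - q') := by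
    rw [mixRatio, mixRatio]
    field_simp
    ring
  have h0 : 0 ≤ (1 - b) * (q * q') + b * p * (q + q') := by positivity
  rw [e, abs_mul, abs_of_nonneg (by positivity)]
  refine mul_le_mul_of_nonneg_right ?_ (abs_nonneg _)
  rw [div_le_iff₀ (by positivity), inv_mul_eq_div, le_div_iff₀ h1]
  -- After clearing denominators, the two sides differ by exactly this term.
  have : 0 ≤ b ^ 2 * p ^ 2 := by positivity
  nlinarith

theorem abs_mixRatio_sub_le_right (hb : 0 < b) (hb' : 0 < b') (hβ : b ≤ β) (hβ' : b' ≤ β)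
    (hβ1 : β < 1) (hq : 0 ≤ q) (hp : 0 < p) :
    |mixRatio b q p - mixRatio b' q p| ≤ |b - b'| * ((1 - β)⁻¹ ^ 2 * (q + p)) := by
  have hm := mix_pos hb (hβ.trans_lt hβ1) hq hp
  have hm' := mix_pos hb' (hβ'.trans_lt hβ1) hq hp
  have h1 : 0 < 1 - β := by linarith
  have e : mixRatio b q p - mixRatio b' q p =
      (b - b') * ((q / ((1 - b) * q + b * p)) * (q / ((1 - b') * q + b' * p)) * (q - p)) := by
    rw [mixRatio, mixRatio, mul_comm _ (q - p), ← mul_assoc,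
      show (b - b') * (q - p) = ((1 - b') * q + b' * p) - ((1 - b) * q + b * p) by ring]
    generalize (1 - b) * q + b * p = m at hm
    generalize (1 - b') * q + b' * p = m' at hm'
    field_simp
  have h2 : ∀ {c : ℝ}, 0 < c → c ≤ β → q / ((1 - c) * q + c * p) ≤ (1 - β)⁻¹ := by
    intro c hc hcβ
    rw [div_le_iff₀ (mix_pos hc (hcβ.trans_lt hβ1) hq hp), inv_mul_eq_div, le_div_iff₀ h1]
    have : 0 ≤ c * p := by positivity
    nlinarith
  rw [e, abs_mul, abs_mul, abs_of_nonneg (a := _ * _) (by positivity), sq]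
  gcongr
  · exact h2 hb hβ
  · exact h2 hb' hβ'
  · rw [abs_le]; constructor <;> linarith

end MixRatio

/-! ### Cutoff functions -/

section Cutoff

/-- Smooth cutoff functions with small gradients. -/
theorem exists_cutoff (d : ℕ) : ∃ (χ : ℕ → Euc d → ℝ) (L : ℝ), 0 ≤ L ∧
    (∀ n, ContDiff ℝ 1 (χ n)) ∧ (∀ n, HasCompactSupport (χ n)) ∧ (∀ n y, |χ n y| ≤ 1) ∧
    (∀ n y, ‖fderiv ℝ (χ n) y‖ ≤ ((n : ℝ) + 1)⁻¹ * L) ∧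
    ∀ y, Tendsto (fun n => χ n y) atTop (𝓝 1) := by
  let f : ContDiffBump (0 : Euc d) := ⟨1, 2, one_pos, by norm_num⟩
  have hf : ContDiff ℝ 1 f := f.contDiff
  have hfc : HasCompactSupport (fderiv ℝ f) := f.hasCompactSupport.fderiv (𝕜 := ℝ)
  obtain ⟨L, hL⟩ := (hf.continuous_fderiv (by norm_num)).bounded_above_of_compact_support hfc
  have hpos : ∀ n : ℕ, (0 : ℝ) < (n + 1 : ℝ)⁻¹ := fun n => by positivity
  have hlim : Tendsto (fun n : ℕ => ((n : ℝ) + 1)⁻¹) atTop (𝓝 0) :=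
    tendsto_inv_atTop_zero.comp (tendsto_atTop_add_const_right _ _ tendsto_natCast_atTop_atTop)
  refine ⟨fun n y => f ((n + 1 : ℝ)⁻¹ • y), L, (norm_nonneg _).trans (hL 0),
    fun n => hf.comp (contDiff_id.const_smul ((n : ℝ) + 1)⁻¹), fun n => ?_, fun n y => ?_,
    fun n y => ?_, fun y => ?_⟩
  · exact f.hasCompactSupport.comp_smul (hpos n).ne'
  · rw [abs_of_nonneg f.nonneg]
    exact f.le_one
  · have h := (hf.differentiable (by norm_num) ((n + 1 : ℝ)⁻¹ • y)).hasFDerivAt.comp y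
      ((hasFDerivAt_id y).const_smul (n + 1 : ℝ)⁻¹)
    have h' : fderiv ℝ (fun y => f ((n + 1 : ℝ)⁻¹ • y)) y =
      (n + 1 : ℝ)⁻¹ • fderiv ℝ f ((n + 1 : ℝ)⁻¹ • y) := by
      refine h.fderiv.trans ?_
      ext v
      simp
    rw [h', norm_smul, Real.norm_of_nonneg (hpos n).le]
    exact mul_le_mul_of_nonneg_left (hL _) (hpos n).le
  · have h1 : Tendsto (fun n : ℕ => ((n : ℝ) + 1)⁻¹ • y) atTop (𝓝 0) := by
      simpa using hlim.smul_const y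
    have h2 := (hf.continuous.tendsto 0).comp h1
    rwa [f.one_of_mem_closedBall (by simp [f])] at h2

end Cutoff

/-! ### Continuity equations and conservation of mass -/

section Flow

variable {p : Euc d → ℝ} {q u : ℝ → Euc d → ℝ} {b₀ : ℝ}

/-- The path `t ↦ mixRatio (b₀ eᵗ) q_t p`. -/
def flowRatio (p : Euc d → ℝ) (q : ℝ → Euc d → ℝ) (b₀ t : ℝ) (y : Euc d) : ℝ :=
  mixRatio (b₀ * Real.exp t) (q t y) (p y)

theorem lt_one_of_lt {s t : ℝ} (hb₀ : 0 < b₀) (hst : s ≤ t) (ht : b₀ * Real.exp t < 1) :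
    b₀ * Real.exp s < 1 :=
  (mul_le_mul_of_nonneg_left (Real.exp_le_exp.2 hst) hb₀.le).trans_lt ht

theorem contDiff_slice (hq : ContDiffOn ℝ 1 (fun z : ℝ × Euc d => q z.1 z.2) (Ioi 0 ×ˢ univ))
    {t : ℝ} (ht : 0 < t) : ContDiff ℝ 1 (q t) := by
  rw [contDiff_iff_contDiffAt]
  intro y
  have h : ContDiffAt ℝ 1 (fun z : ℝ × Euc d => q z.1 z.2) (t, y) :=
    hq.contDiffAt ((isOpen_Ioi.prod isOpen_univ).mem_nhds ⟨ht, trivial⟩)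
  exact h.comp y (contDiffAt_const.prodMk contDiffAt_id)

/-- The growth of `b = b₀ eᵗ` is what makes `(1 - b) q + b p` solve the same continuity equation as
`q`: its time derivative contributes `b (p - q)`, which is `b div(p ∇u)`. The quotient `q²/m` is
1-homogeneous in two transported densities, so it is transported as well. -/
theorem hasDerivAt_flowRatio (hb₀ : 0 < b₀) (hp : ContDiff ℝ 1 p) (hp0 : ∀ y, 0 < p y)
    {t : ℝ} (ht : b₀ * Real.exp t < 1) (hq0 : ∀ y, 0 ≤ q t y) (hq : ContDiff ℝ 1 (q t))
    (hu : ContDiff ℝ 2 (u t))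
    (hpu : ∀ y, divergence (fun z => p z • gradient (u t) z) y = p y - q t y) (y : Euc d)
    (heq : HasDerivAt (fun s => q s y) (divergence (fun z => q t z • gradient (u t) z) y) t) :
    HasDerivAt (fun s => flowRatio p q b₀ s y)
      (divergence (fun z => flowRatio p q b₀ t z • gradient (u t) z) y) t := by
  have hG := (contDiff_gradient hu (n := 1) (by norm_num)).differentiable (by norm_num) y
  have hqd := hq.differentiable (by norm_num) y
  have hpd := hp.differentiable (by norm_num) y
  have hm := mix_pos (mul_pos hb₀ (Real.exp_pos t)) ht (hq0 y) (hp0 y)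
  set b := b₀ * Real.exp t with hb
  have hbd : HasDerivAt (fun s => b₀ * Real.exp s) b t := (Real.hasDerivAt_exp t).const_mul b₀
  have hD : HasFDerivAt (flowRatio p q b₀ t)
      ((((1 - b) * q t y + b * p y) ^ 2)⁻¹ • (((1 - b) * q t y + b * p y) •
        ((2 * q t y) • fderiv ℝ (q t) y) - (q t y ^ 2) •
          ((1 - b) • fderiv ℝ (q t) y + b • fderiv ℝ p y))) y := by
    have h1 := hqd.hasFDerivAt.pow 2
    have h2 := (hqd.hasFDerivAt.const_mul (1 - b)).fun_add (hpd.hasFDerivAt.const_mul b)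
    have h3 := h1.fun_mul ((hasDerivAt_inv hm.ne').comp_hasFDerivAt y h2)
    change HasFDerivAt (fun z => mixRatio b (q t z) (p z)) _ y
    simp only [mixRatio, div_eq_mul_inv]
    refine h3.congr_fderiv ?_
    ext v
    simp only [smul_apply, sub_apply, add_apply, smul_eq_mul, Function.comp_apply, nsmul_eq_mul]
    push_cast
    field_simp
    ring
  have h1 := divergence_smul hpd hG
  rw [hpu y] at h1
  rw [divergence_smul hqd hG] at heq
  rw [divergence_smul hD.differentiableAt hG, hD.fderiv]
  have h2 := (heq.fun_pow 2).fun_div ((((hasDerivAt_const t (1 : ℝ)).fun_sub hbd).fun_mul heq).fun_add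
    (hbd.mul_const (p y))) hm.ne'
  simp only [flowRatio, mixRatio]
  refine h2.congr_deriv ?_
  -- The potential equation, expanded by the product rule, eliminates `⟨∇p, ∇u⟩`.
  have h3 : fderiv ℝ p y (gradient (u t) y) =
    p y - q t y - p y * divergence (gradient (u t)) y := by linarith
  simp only [smul_apply, sub_apply, add_apply, smul_eq_mul, h3, ← hb]
  field_simp
  ring

theorem contDiffOn_flowRatio (hb₀ : 0 < b₀) (hp : ContDiff ℝ 1 p) (hp0 : ∀ y, 0 < p y)
    (hq0 : ∀ t, 0 ≤ t → ∀ y, 0 ≤ q t y)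
    (hq : ContDiffOn ℝ 1 (fun z : ℝ × Euc d => q z.1 z.2) (Ioi 0 ×ˢ univ)) :
    ContDiffOn ℝ 1 (fun z : ℝ × Euc d => flowRatio p q b₀ z.1 z.2)
      ({t | 0 < t ∧ b₀ * Real.exp t < 1} ×ˢ univ) := by
  have hq' : ContDiffOn ℝ 1 (fun z : ℝ × Euc d => q z.1 z.2)
      ({t | 0 < t ∧ b₀ * Real.exp t < 1} ×ˢ univ) :=
    hq.mono fun z hz => ⟨hz.1.1, trivial⟩
  have hb : ContDiff ℝ 1 fun z : ℝ × Euc d => b₀ * Real.exp z.1 := by fun_prop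
  have hp' : ContDiff ℝ 1 fun z : ℝ × Euc d => p z.2 := hp.comp contDiff_snd
  refine (hq'.pow 2).div (((contDiff_const.sub hb).contDiffOn.mul hq').add
    (hb.mul hp').contDiffOn) ?_
  rintro ⟨t, y⟩ ⟨ht, -⟩
  exact (mix_pos (mul_pos hb₀ (Real.exp_pos t)) ht.2 (hq0 t ht.1.le y) (hp0 y)).ne'

/-- The change of a localized integral along a continuity equation. -/
theorem enorm_integral_cutoff_sub_le {G : ℝ → Euc d → ℝ} {v : ℝ → Euc d → Euc d}
    {χ : Euc d → ℝ} {s t L C : ℝ} {S : Set ℝ} (hS : IsOpen S) (hst : s ≤ t) (hsub : Icc s t ⊆ S)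
    (hG : ContDiffOn ℝ 1 (fun z : ℝ × Euc d => G z.1 z.2) (S ×ˢ univ))
    (hv : ∀ r ∈ S, ContDiff ℝ 1 (v r))
    (heq : ∀ r ∈ S, ∀ y, HasDerivAt (fun r => G r y)
      (divergence (fun z => G r z • v r z) y) r)
    (hχ : ContDiff ℝ 1 χ) (hχc : HasCompactSupport χ) (hL : ∀ y, ‖fderiv ℝ χ y‖ ≤ L)
    (hq0 : ∀ r ∈ S, ∀ y, 0 ≤ q r y) (hqm : ∀ r ∈ S, Measurable (q r))
    (hGq : ∀ r ∈ Icc s t, ∀ y, |G r y| ≤ C * q r y) (hL0 : 0 ≤ L) (hC0 : 0 ≤ C) :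
    ‖∫ y, χ y * G t y - χ y * G s y‖ₑ ≤ ENNReal.ofReal (L * C) *
      ∫⁻ r in Icc s t, ∫⁻ y, ‖v r y‖ₑ
        ∂(volume.withDensity fun y => ENNReal.ofReal (q r y)) := by
  have hopen : IsOpen (S ×ˢ (univ : Set (Euc d))) := hS.prod isOpen_univ
  set D : ℝ × Euc d → ℝ :=
    fun z => fderiv ℝ (fun z : ℝ × Euc d => G z.1 z.2) z (1, 0) with hDdef
  have hDcont : ContinuousOn D (S ×ˢ univ) :=
    (hG.continuousOn_fderiv_of_isOpen hopen (by norm_num)).clm_apply continuousOn_const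
  have hDeq : ∀ r ∈ S, ∀ y, D (r, y) = divergence (fun z => G r z • v r z) y := by
    intro r hr y
    have h1 : HasFDerivAt (fun z : ℝ × Euc d => G z.1 z.2) _ (r, y) :=
      ((hG.contDiffAt (hopen.mem_nhds ⟨hr, trivial⟩)).differentiableAt (by norm_num)).hasFDerivAt
    have h2 : HasDerivAt (fun r : ℝ => ((r, y) : ℝ × Euc d)) (1, 0) r :=
      (hasDerivAt_id r).prodMk (hasDerivAt_const r y)
    have h3 : HasDerivAt (fun r => G r y) (D (r, y)) r := by
      exact HasFDerivAt.comp_hasDerivAt (l := fun z : ℝ × Euc d => G z.1 z.2)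
        (f := fun r => (r, y)) r h1 h2
    exact h3.unique (heq r hr y)
  have hslice : ∀ r ∈ S, ContDiff ℝ 1 (G r) := by
    intro r hr
    rw [contDiff_iff_contDiffAt]
    intro y
    exact (hG.contDiffAt (hopen.mem_nhds (⟨hr, trivial⟩ : (r, y) ∈ S ×ˢ univ))).comp y
      (contDiffAt_const.prodMk contDiffAt_id)
  -- Fundamental theorem of calculus in time at each fixed point; Fubini then lets the spatial
  -- integral be integrated by parts at each time.
  have hftc : ∀ y, χ y * G t y - χ y * G s y = ∫ r in Ioc s t, χ y * D (r, y) := by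
    intro y
    have hc : ContinuousOn (fun r => D (r, y)) (uIcc s t) := by
      rw [uIcc_of_le hst]
      exact hDcont.comp (by fun_prop) fun r hr => ⟨hsub hr, trivial⟩
    have h := intervalIntegral.integral_eq_sub_of_hasDerivAt (f := fun r => G r y)
      (f' := fun r => D (r, y)) (a := s) (b := t) (fun r hr => by
        rw [uIcc_of_le hst] at hr
        rw [hDeq r (hsub hr)]
        exact heq r (hsub hr) y) hc.intervalIntegrable
    rw [integral_const_mul, ← intervalIntegral.integral_of_le hst, h, mul_sub]
  have hint : Integrable (Function.uncurry fun y r => χ y * D (r, y))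
      (volume.prod (volume.restrict (Ioc s t))) := by
    have hK : IsCompact (tsupport χ ×ˢ Icc s t) := hχc.isCompact.prod isCompact_Icc
    have h1 : IntegrableOn (fun z : Euc d × ℝ => χ z.1 * D (z.2, z.1)) (tsupport χ ×ˢ Icc s t)
        (volume.prod volume) :=
      ContinuousOn.integrableOn_compact hK ((hχ.continuous.comp continuous_fst).continuousOn.mul
        (hDcont.comp (by fun_prop) fun z hz => ⟨hsub hz.2, trivial⟩))
    have h2 : IntegrableOn (fun z : Euc d × ℝ => χ z.1 * D (z.2, z.1)) (univ ×ˢ Icc s t)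
        (volume.prod volume) := by
      refine h1.of_forall_sdiff_eq_zero (MeasurableSet.univ.prod measurableSet_Icc) ?_
      rintro ⟨y, r⟩ ⟨hz, hz'⟩
      have : y ∉ tsupport χ := fun hy => hz' ⟨hy, hz.2⟩
      simp [image_eq_zero_of_notMem_tsupport this]
    have h3 := h2.mono_set (prod_mono (subset_refl univ) (Ioc_subset_Icc_self (a := s) (b := t)))
    rwa [IntegrableOn, ← Measure.prod_restrict, Measure.restrict_univ] at h3
  simp_rw [hftc]
  rw [integral_integral_swap hint]
  refine (enorm_integral_le_lintegral_enorm _).trans ?_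
  refine (lintegral_mono_set Ioc_subset_Icc_self).trans ?_
  rw [← lintegral_const_mul' _ _ ENNReal.ofReal_ne_top]
  refine setLIntegral_mono' measurableSet_Icc fun r hr => ?_
  have hrS := hsub hr
  have hF : ContDiff ℝ 1 fun z => G r z • v r z := (hslice r hrS).smul (hv r hrS)
  have e : ∫ y, χ y * D (r, y) = -∫ y, fderiv ℝ χ y (G r y • v r y) := by
    simp_rw [hDeq r hrS]
    exact integral_mul_divergence hχ hF (Or.inl hχc)
  rw [e, enorm_neg, lintegral_withDensity_eq_lintegral_mul _ (hqm r hrS).ennreal_ofReal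
    (hv r hrS).continuous.enorm.measurable, ← lintegral_const_mul' _ _ ENNReal.ofReal_ne_top]
  refine (enorm_integral_le_lintegral_enorm _).trans (lintegral_mono fun y => ?_)
  simp only [Pi.mul_apply]
  rw [← ofReal_norm (v r y), ← ENNReal.ofReal_mul (hq0 r hrS y),
    ← ENNReal.ofReal_mul (by positivity), ← ofReal_norm]
  refine ENNReal.ofReal_le_ofReal ?_
  calc ‖fderiv ℝ χ y (G r y • v r y)‖ ≤ ‖fderiv ℝ χ y‖ * ‖G r y • v r y‖ :=
        ContinuousLinearMap.le_opNorm _ _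
    _ = ‖fderiv ℝ χ y‖ * (|G r y| * ‖v r y‖) := by rw [norm_smul, Real.norm_eq_abs]
    _ ≤ L * (C * q r y * ‖v r y‖) := by
        gcongr
        · exact hL y
        · exact hGq r hr y
    _ = L * C * (q r y * ‖v r y‖) := by ring

/-- Conservation of the total mass along a continuity equation with integrable flux. -/
theorem integral_eq_of_continuity_equation {G : ℝ → Euc d → ℝ} {v : ℝ → Euc d → Euc d}
    {s t C : ℝ} {S : Set ℝ} (hS : IsOpen S) (hst : s ≤ t) (hsub : Icc s t ⊆ S)
    (hG : ContDiffOn ℝ 1 (fun z : ℝ × Euc d => G z.1 z.2) (S ×ˢ univ))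
    (hv : ∀ r ∈ S, ContDiff ℝ 1 (v r))
    (heq : ∀ r ∈ S, ∀ y, HasDerivAt (fun r => G r y)
      (divergence (fun z => G r z • v r z) y) r)
    (hq0 : ∀ r ∈ S, ∀ y, 0 ≤ q r y) (hqm : ∀ r ∈ S, Measurable (q r))
    (hGq : ∀ r ∈ Icc s t, ∀ y, |G r y| ≤ C * q r y) (hC0 : 0 ≤ C)
    (hGs : Integrable (G s)) (hGt : Integrable (G t))
    (hfin : ∫⁻ r in Icc s t, ∫⁻ y, ‖v r y‖ₑ
        ∂(volume.withDensity fun y => ENNReal.ofReal (q r y)) ≠ ⊤) :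
    ∫ y, G t y = ∫ y, G s y := by
  obtain ⟨χ, L, hL0, hχ, hχc, hχ1, hχL, hχlim⟩ := exists_cutoff d
  set K := ∫⁻ r in Icc s t, ∫⁻ y, ‖v r y‖ₑ
        ∂(volume.withDensity fun y => ENNReal.ofReal (q r y)) with hK
  have hlim : Tendsto (fun n => ∫ y, χ n y * G t y - χ n y * G s y) atTop
      (𝓝 (∫ y, 1 * G t y - 1 * G s y)) := by
    refine tendsto_integral_of_dominated_convergence (fun y => |G t y| + |G s y|) (fun n => ?_)
      (hGt.abs.add hGs.abs) (fun n => Eventually.of_forall fun y => ?_)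
      (Eventually.of_forall fun y => ((hχlim y).mul_const _).sub ((hχlim y).mul_const _))
    · exact ((hχ n).continuous.aestronglyMeasurable.mul hGt.aestronglyMeasurable).sub
        ((hχ n).continuous.aestronglyMeasurable.mul hGs.aestronglyMeasurable)
    · rw [← mul_sub, norm_mul, Real.norm_eq_abs, Real.norm_eq_abs]
      calc |χ n y| * |G t y - G s y| ≤ 1 * |G t y - G s y| :=
            mul_le_mul_of_nonneg_right (hχ1 n y) (abs_nonneg _)
        _ ≤ _ := by rw [one_mul]; exact abs_sub _ _
  -- The cutoff gradient is of order `1/n` and the total flux over `[s, t]` is finite, so the defect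
  -- tends to zero.
  have hbd : ∀ n : ℕ, ‖∫ y, χ n y * G t y - χ n y * G s y‖ ≤
      ((n : ℝ) + 1)⁻¹ * (L * C * K.toReal) := by
    intro n
    have h := enorm_integral_cutoff_sub_le hS hst hsub hG hv heq (hχ n) (hχc n) (hχL n) hq0 hqm
      hGq (by positivity) hC0
    rw [← hK, ← ENNReal.ofReal_toReal hfin, ← ENNReal.ofReal_mul (by positivity),
      ← ofReal_norm, ENNReal.ofReal_le_ofReal_iff (by positivity)] at h
    calc _ ≤ _ := h
      _ = _ := by ring
  have hlim0 : Tendsto (fun n : ℕ => ((n : ℝ) + 1)⁻¹ * (L * C * K.toReal)) atTop (𝓝 0) := by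
    have : Tendsto (fun n : ℕ => ((n : ℝ) + 1)⁻¹) atTop (𝓝 0) :=
      tendsto_inv_atTop_zero.comp (tendsto_atTop_add_const_right _ _ tendsto_natCast_atTop_atTop)
    simpa using this.mul_const (L * C * K.toReal)
  have h0 := tendsto_nhds_unique hlim (squeeze_zero_norm hbd hlim0)
  simp only [one_mul] at h0
  rw [integral_sub hGt hGs] at h0
  linarith

end Flow

/-! ### Relative entropy as an integral of mixture divergences -/

section Divergence

/-- An integral representation of the relative entropy function. -/
theorem ofReal_klFun_eq_lintegral {ρ : ℝ} (hρ : 0 ≤ ρ) :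
    ENNReal.ofReal (InformationTheory.klFun ρ) =
      ∫⁻ b in Ioo (0 : ℝ) 1, ENNReal.ofReal (b * (ρ - 1) ^ 2 / ((1 - b) * ρ + b)) := by
  rcases hρ.eq_or_lt with rfl | hρ0
  · have : ∫⁻ b in Ioo (0 : ℝ) 1, ENNReal.ofReal (b * (0 - 1) ^ 2 / ((1 - b) * 0 + b)) =
        ∫⁻ _ in Ioo (0 : ℝ) 1, 1 := by
      refine setLIntegral_congr_fun measurableSet_Ioo fun b hb => ?_
      have := hb.1.ne'
      simp [this]
    rw [this]
    simp [InformationTheory.klFun_zero]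
  · have hm : ∀ b ∈ Icc (0 : ℝ) 1, 0 < (1 - b) * ρ + b := by
      rintro b ⟨h0, h1⟩
      rcases h0.eq_or_lt with rfl | h0
      · simpa using hρ0
      · have : 0 ≤ (1 - b) * ρ := mul_nonneg (by linarith) hρ
        linarith
    have hcont : ContinuousOn (fun b : ℝ => b * (ρ - 1) ^ 2 / ((1 - b) * ρ + b)) (Icc 0 1) :=
      ContinuousOn.div (by fun_prop) (by fun_prop) fun b hb => (hm b hb).ne'
    -- The antiderivative equals `-ρ log ρ` at `b = 0` and `1 - ρ` at `b = 1`; the difference is `ρ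
    -- log ρ + 1 - ρ`.
    have hftc := intervalIntegral.integral_eq_sub_of_hasDerivAt (a := 0) (b := 1)
      (f := fun b : ℝ => -(ρ * Real.log ((1 - b) * ρ + b)) - (ρ - 1) * b)
      (f' := fun b : ℝ => b * (ρ - 1) ^ 2 / ((1 - b) * ρ + b)) (fun b hb => by
        rw [uIcc_of_le zero_le_one] at hb
        have h0 := hm b hb
        have h1 : HasDerivAt (fun b : ℝ => (1 - b) * ρ + b) ((0 - 1) * ρ + 1) b :=
          (((hasDerivAt_const b (1 : ℝ)).fun_sub (hasDerivAt_id' b)).mul_const ρ).fun_add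
            (hasDerivAt_id' b)
        refine (((h1.log h0.ne').const_mul ρ).fun_neg.fun_sub
          ((hasDerivAt_id' b).const_mul (ρ - 1))).congr_deriv ?_
        generalize hM : (1 - b) * ρ + b = m at h0
        field_simp
        rw [← hM]
        ring) (by
        rw [← uIcc_of_le zero_le_one] at hcont
        exact hcont.intervalIntegrable)
    have hint : IntegrableOn (fun b : ℝ => b * (ρ - 1) ^ 2 / ((1 - b) * ρ + b)) (Ioo 0 1) :=
      (hcont.integrableOn_compact isCompact_Icc).mono_set Ioo_subset_Icc_self
    rw [← ofReal_integral_eq_lintegral_ofReal hint]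
    · rw [← integral_Ioc_eq_integral_Ioo, ← intervalIntegral.integral_of_le zero_le_one, hftc,
        InformationTheory.klFun_apply]
      congr 1
      simp
      ring
    · refine (ae_restrict_mem measurableSet_Ioo).mono fun b hb => ?_
      exact div_nonneg (mul_nonneg hb.1.le (sq_nonneg _)) (hm b (Ioo_subset_Icc_self hb)).le

/-- The divergence `b ∫ (q - p)² / ((1 - b) q + b p)`. -/
def mixDiv (p q : Euc d → ℝ) (b : ℝ) : ENNReal :=
  ∫⁻ y, ENNReal.ofReal (b * (q y - p y) ^ 2 / ((1 - b) * q y + b * p y))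

variable {p q : Euc d → ℝ} {ν η : Measure (Euc d)}

theorem withDensity_eq_withDensity_div (hp : Measurable p) (hp0 : ∀ y, 0 < p y)
    (hq : Measurable q)
    (hν : ν = volume.withDensity fun y => ENNReal.ofReal (p y))
    (hη : η = volume.withDensity fun y => ENNReal.ofReal (q y)) :
    η = ν.withDensity fun y => ENNReal.ofReal (q y / p y) := by
  rw [hη, hν, ← withDensity_mul _ hp.ennreal_ofReal (hq.fun_div hp).ennreal_ofReal]
  congr 1
  funext y
  rw [Pi.mul_apply, ← ENNReal.ofReal_mul (hp0 y).le, mul_div_cancel₀ _ (hp0 y).ne']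

theorem relDensity_ae_eq (hp : Measurable p) (hp0 : ∀ y, 0 < p y)
    (hq : Measurable q) (hq0 : ∀ y, 0 ≤ q y) [IsFiniteMeasure ν]
    (hν : ν = volume.withDensity fun y => ENNReal.ofReal (p y))
    (hη : η = volume.withDensity fun y => ENNReal.ofReal (q y)) :
    relDensity η ν =ᵐ[ν] fun y => q y / p y := by
  have h := Measure.rnDeriv_withDensity ν (hq.div hp).ennreal_ofReal
  have h2 := withDensity_eq_withDensity_div hp hp0 hq hν hη
  filter_upwards [h] with y hy
  rw [relDensity, h2]
  refine (congrArg ENNReal.toReal hy).trans ?_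
  rw [Pi.div_apply, ENNReal.toReal_ofReal (div_nonneg (hq0 y) (hp0 y).le)]

/-- Apply the integral representation at `ρ = q/p`, absorb the weight `p` by homogeneity, and
exchange the integrals by Tonelli. No finiteness of the entropy is required. -/
theorem klDiv_eq_lintegral_mixDiv (hp : Measurable p) (hp0 : ∀ y, 0 < p y)
    (hq : Measurable q) (hq0 : ∀ y, 0 ≤ q y) [IsFiniteMeasure ν] [IsFiniteMeasure η]
    (hν : ν = volume.withDensity fun y => ENNReal.ofReal (p y))
    (hη : η = volume.withDensity fun y => ENNReal.ofReal (q y)) :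
    InformationTheory.klDiv η ν = ∫⁻ b in Ioo (0 : ℝ) 1, mixDiv p q b := by
  have hac : η ≪ ν := by
    rw [withDensity_eq_withDensity_div hp hp0 hq hν hη]
    exact withDensity_absolutelyContinuous _ _
  rw [InformationTheory.klDiv_eq_lintegral_klFun_of_ac hac]
  have h1 : ∫⁻ y, ENNReal.ofReal (InformationTheory.klFun (η.rnDeriv ν y).toReal) ∂ν =
      ∫⁻ y, ENNReal.ofReal (InformationTheory.klFun (q y / p y)) ∂ν := by
    refine lintegral_congr_ae ?_
    filter_upwards [relDensity_ae_eq hp hp0 hq hq0 hν hη] with y hy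
    rw [← hy, relDensity]
  rw [h1, hν, lintegral_withDensity_eq_lintegral_mul _ hp.ennreal_ofReal
    (by fun_prop : Measurable fun y => ENNReal.ofReal (InformationTheory.klFun (q y / p y)))]
  have h2 : ∀ y, ((fun y => ENNReal.ofReal (p y)) *
      fun y => ENNReal.ofReal (InformationTheory.klFun (q y / p y))) y =
      ∫⁻ b in Ioo (0 : ℝ) 1,
        ENNReal.ofReal (b * (q y - p y) ^ 2 / ((1 - b) * q y + b * p y)) := by
    intro y
    have hpy := hp0 y
    rw [Pi.mul_apply, ofReal_klFun_eq_lintegral (div_nonneg (hq0 y) hpy.le),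
      ← lintegral_const_mul' _ _ ENNReal.ofReal_ne_top]
    refine setLIntegral_congr_fun measurableSet_Ioo fun b hb => ?_
    have hm := mix_pos hb.1 hb.2 (hq0 y) hpy
    have hm' := mix_pos hb.1 hb.2 (div_nonneg (hq0 y) hpy.le) one_pos
    rw [mul_one] at hm'
    rw [← ENNReal.ofReal_mul hpy.le]
    congr 1
    have e : (1 - b) * (q y / p y) + b = ((1 - b) * q y + b * p y) / p y := by
      field_simp
    rw [e]
    field_simp
  simp_rw [h2]
  exact lintegral_lintegral_swap (Measurable.aemeasurable (by
    simp only [Function.uncurry_def]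
    fun_prop))

theorem integrable_of_isProbabilityMeasure [IsProbabilityMeasure η] (hq : Measurable q)
    (hq0 : ∀ y, 0 ≤ q y) (hη : η = volume.withDensity fun y => ENNReal.ofReal (q y)) :
    Integrable q ∧ ∫ y, q y = 1 := by
  have h1 : ∫⁻ y, ENNReal.ofReal (q y) = 1 := by
    have : η univ = 1 := measure_univ
    rwa [hη, withDensity_apply _ MeasurableSet.univ, Measure.restrict_univ] at this
  constructor
  · rw [← lintegral_ofReal_ne_top_iff_integrable hq.aestronglyMeasurable
      (Eventually.of_forall hq0), h1]
    exact ENNReal.one_ne_top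
  · rw [integral_eq_lintegral_of_nonneg_ae (Eventually.of_forall hq0) hq.aestronglyMeasurable, h1,
      ENNReal.toReal_one]

variable {b c : ℝ}

theorem integrable_mixRatio (hp : Measurable p) (hp0 : ∀ y, 0 < p y) (hq : Integrable q)
    (hqm : Measurable q) (hq0 : ∀ y, 0 ≤ q y) (hb : 0 < b) (hb1 : b < 1) :
    Integrable fun y => mixRatio b (q y) (p y) := by
  refine (hq.const_mul (1 - b)⁻¹).mono'
    (by unfold mixRatio; exact Measurable.aestronglyMeasurable (by fun_prop))
    (Eventually.of_forall fun y => ?_)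
  rw [Real.norm_of_nonneg (mixRatio_nonneg hb hb1 (hq0 y) (hp0 y))]
  exact mixRatio_le hb hb1 (hq0 y) (hp0 y)

/-- With `m = (1 - b) q + b p`, one has `b² (q - p)² = q² - m ((1 + b) q - b p)`; after division by
`m` the linear correction integrates to `1`. -/
theorem mixDiv_eq (hpm : Measurable p) (hp0 : ∀ y, 0 < p y) (hp : Integrable p)
    (hp1 : ∫ y, p y = 1) (hq : Integrable q) (hqm : Measurable q) (hq0 : ∀ y, 0 ≤ q y)
    (hq1 : ∫ y, q y = 1) (hb : 0 < b) (hb1 : b < 1) :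
    mixDiv p q b = ENNReal.ofReal (b⁻¹ * ((∫ y, mixRatio b (q y) (p y)) - 1)) := by
  have hf := integrable_mixRatio hpm hp0 hq hqm hq0 hb hb1
  have e : ∀ y, b * (q y - p y) ^ 2 / ((1 - b) * q y + b * p y) =
      b⁻¹ * (mixRatio b (q y) (p y) - ((1 + b) * q y - b * p y)) := by
    intro y
    have hm := mix_pos hb hb1 (hq0 y) (hp0 y)
    rw [mixRatio]
    generalize hM : (1 - b) * q y + b * p y = m at hm
    field_simp
    rw [← hM]
    ring
  have hlin : Integrable fun y => (1 + b) * q y - b * p y :=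
    (hq.const_mul _).sub (hp.const_mul _)
  have hint : Integrable fun y => b⁻¹ * (mixRatio b (q y) (p y) - ((1 + b) * q y - b * p y)) :=
    (hf.sub hlin).const_mul _
  rw [mixDiv]
  simp_rw [e]
  rw [← ofReal_integral_eq_lintegral_ofReal hint (Eventually.of_forall fun y => ?_)]
  · rw [integral_const_mul, integral_sub hf hlin, integral_sub (hq.const_mul _) (hp.const_mul _),
      integral_const_mul, integral_const_mul, hp1, hq1]
    congr 3
    ring
  · simp only [Pi.zero_apply]
    rw [← e y]
    exact div_nonneg (mul_nonneg hb.le (sq_nonneg _)) (mix_pos hb hb1 (hq0 y) (hp0 y)).le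

/-- Pointwise, `b / ((1 - b) q + b p)` is nondecreasing in `b`, as its reciprocal is `(1/b - 1) q +
p`. -/
theorem mixDiv_mono (hp0 : ∀ y, 0 < p y) (hq0 : ∀ y, 0 ≤ q y) (hc : 0 < c) (hcb : c ≤ b)
    (hb1 : b < 1) : mixDiv p q c ≤ mixDiv p q b := by
  refine lintegral_mono fun y => ENNReal.ofReal_le_ofReal ?_
  rw [div_le_div_iff₀ (mix_pos hc (hcb.trans_lt hb1) (hq0 y) (hp0 y))
    (mix_pos (hc.trans_le hcb) hb1 (hq0 y) (hp0 y))]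
  have h1 : c * ((1 - b) * q y + b * p y) ≤ b * ((1 - c) * q y + c * p y) := by
    nlinarith [mul_le_mul_of_nonneg_right hcb (hq0 y)]
  nlinarith [mul_le_mul_of_nonneg_left h1 (sq_nonneg (q y - p y))]

/-- The bound `q²/m ≤ q/(1 - b)` gives `b⁻¹ ((1 - b)⁻¹ - 1)`, which is exactly `(1 - b)⁻¹`; it
involves no entropy of `q`. -/
theorem mixDiv_le (hpm : Measurable p) (hp0 : ∀ y, 0 < p y) (hp : Integrable p)
    (hp1 : ∫ y, p y = 1) (hq : Integrable q) (hqm : Measurable q) (hq0 : ∀ y, 0 ≤ q y)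
    (hq1 : ∫ y, q y = 1) (hb : 0 < b) (hb1 : b < 1) :
    mixDiv p q b ≤ ENNReal.ofReal (1 - b)⁻¹ := by
  rw [mixDiv_eq hpm hp0 hp hp1 hq hqm hq0 hq1 hb hb1]
  refine ENNReal.ofReal_le_ofReal ?_
  have h1 : ∫ y, mixRatio b (q y) (p y) ≤ ∫ y, (1 - b)⁻¹ * q y :=
    integral_mono (integrable_mixRatio hpm hp0 hq hqm hq0 hb hb1) (hq.const_mul _)
      fun y => mixRatio_le hb hb1 (hq0 y) (hp0 y)
  rw [integral_const_mul, hq1, mul_one] at h1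
  have h2 : 0 < 1 - b := by linarith
  calc b⁻¹ * ((∫ y, mixRatio b (q y) (p y)) - 1) ≤ b⁻¹ * ((1 - b)⁻¹ - 1) := by gcongr
    _ = (1 - b)⁻¹ := by field_simp; ring

end Divergence

/-! ### The conserved quantity along the flow and entropy decay -/

section Invariance

variable {ν : Measure (Euc d)} {k : Euc d → Euc d → ℝ} {η : ℝ → Measure (Euc d)}
  {q u : ℝ → Euc d → ℝ} {p : Euc d → ℝ} {b₀ t : ℝ}

theorem IsLaplacianAdjustedFlow.integrable (h : IsLaplacianAdjustedFlow ν k η q u)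
    (ht : 0 ≤ t) : Integrable (q t) ∧ ∫ y, q t y = 1 := by
  have := h.prob t ht
  exact integrable_of_isProbabilityMeasure (h.measurable t ht) (h.nonneg t ht) (h.density t ht)

/-- Velocity integrability is assumed only on intervals away from time `0`, so the initial time is
reached by continuity. The difference is split into a change of `q` at fixed `b` and a change of `b`
at fixed `q`. -/
theorem IsLaplacianAdjustedFlow.tendsto_integral_flowRatio
    (h : IsLaplacianAdjustedFlow ν k η q u) (hp : Measurable p) (hp0 : ∀ y, 0 < p y)
    (hpi : Integrable p) (hb₀ : 0 < b₀) (ht : 0 < t) (hbt : b₀ * Real.exp t < 1) :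
    Tendsto (fun s => ∫ y, flowRatio p q b₀ s y) (𝓝[>] 0) (𝓝 (∫ y, flowRatio p q b₀ 0 y)) := by
  set β := b₀ * Real.exp t with hβ
  have hint : ∀ {s}, 0 ≤ s → s ≤ t → Integrable (flowRatio p q b₀ s) := fun hs hst =>
    integrable_mixRatio hp hp0 (h.integrable hs).1 (h.measurable _ hs) (h.nonneg _ hs)
      (by positivity) (lt_one_of_lt hb₀ hst hbt)
  have hb0 : b₀ * Real.exp 0 ≤ β := mul_le_mul_of_nonneg_left (Real.exp_le_exp.2 ht.le) hb₀.le
  have hL1 : Tendsto (fun s => ∫ y, |q s y - q 0 y|) (𝓝[>] 0) (𝓝 0) := by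
    have h1 := (ENNReal.tendsto_toReal ENNReal.zero_ne_top).comp h.initial
    rw [ENNReal.toReal_zero] at h1
    refine h1.congr' ?_
    filter_upwards [self_mem_nhdsWithin] with s hs
    have hs0 : (0 : ℝ) ≤ s := le_of_lt hs
    have := integral_norm_eq_lintegral_enorm
      ((h.measurable s hs0).sub (h.measurable 0 le_rfl)).aestronglyMeasurable (μ := volume)
    exact this.symm
  have hexp : Tendsto (fun s => |b₀ * Real.exp s - b₀ * Real.exp 0|) (𝓝[>] 0) (𝓝 0) := by
    have hc : Continuous fun s => |b₀ * Real.exp s - b₀ * Real.exp 0| := by fun_prop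
    have := (hc.tendsto 0).mono_left (nhdsWithin_le_nhds (s := Ioi 0))
    simpa using this
  have hbound : Tendsto (fun s => (1 - β)⁻¹ * (∫ y, |q s y - q 0 y|) +
      |b₀ * Real.exp s - b₀ * Real.exp 0| * ((1 - β)⁻¹ ^ 2 * ∫ y, (q 0 y + p y)))
      (𝓝[>] 0) (𝓝 0) := by
    simpa only [mul_zero, zero_mul, add_zero] using (hL1.const_mul (1 - β)⁻¹).add
      (hexp.mul_const ((1 - β)⁻¹ ^ 2 * ∫ y, (q 0 y + p y)))
  rw [tendsto_iff_dist_tendsto_zero]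
  refine squeeze_zero' (Eventually.of_forall fun _ => dist_nonneg) ?_ hbound
  filter_upwards [Ioo_mem_nhdsGT ht] with s hs
  have hs0 : 0 ≤ s := hs.1.le
  have hq := (h.integrable hs0).1
  have hq' := (h.integrable le_rfl).1
  have hbs : b₀ * Real.exp s ≤ β :=
    mul_le_mul_of_nonneg_left (Real.exp_le_exp.2 hs.2.le) hb₀.le
  have hI1 : Integrable fun y => (1 - β)⁻¹ * |q s y - q 0 y| := (hq.sub hq').abs.const_mul _
  have hI2 : Integrable fun y => |b₀ * Real.exp s - b₀ * Real.exp 0| *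
      ((1 - β)⁻¹ ^ 2 * (q 0 y + p y)) := ((hq'.add hpi).const_mul _).const_mul _
  rw [Real.dist_eq, ← integral_sub (hint hs0 hs.2.le) (hint le_rfl ht.le)]
  refine abs_integral_le_integral_abs.trans ?_
  rw [← integral_const_mul, ← integral_const_mul, ← integral_const_mul, ← integral_add hI1 hI2]
  refine integral_mono ((hint hs0 hs.2.le).sub (hint le_rfl ht.le)).abs (hI1.add hI2) fun y => ?_
  have h1 := abs_mixRatio_sub_le_left (b := b₀ * Real.exp s) (by positivity)
    (hbs.trans_lt hbt) (h.nonneg s hs0 y) (h.nonneg 0 le_rfl y) (hp0 y)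
  have h2 := abs_mixRatio_sub_le_right (b := b₀ * Real.exp s) (b' := b₀ * Real.exp 0)
    (by positivity) (by positivity) hbs hb0 hbt (h.nonneg 0 le_rfl y) (hp0 y)
  have h3 : (1 - b₀ * Real.exp s)⁻¹ ≤ (1 - β)⁻¹ := inv_anti₀ (by linarith) (by linarith)
  have h4 := mul_le_mul_of_nonneg_right h3 (abs_nonneg (q s y - q 0 y))
  exact (abs_sub_le _ (mixRatio (b₀ * Real.exp s) (q 0 y) (p y)) _).trans
    (add_le_add (h1.trans h4) h2)

/-- Along the flow, `∫ q_t² / ((1 - b₀ eᵗ) q_t + b₀ eᵗ p)` is constant in time. -/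
theorem IsLaplacianAdjustedFlow.integral_flowRatio_eq
    (h : IsLaplacianAdjustedFlow ν k η q u) (hp : ContDiff ℝ 1 p) (hp0 : ∀ y, 0 < p y)
    (hpi : Integrable p)
    (hpu : ∀ t, 0 < t → ∀ y, divergence (fun z => p z • gradient (u t) z) y = p y - q t y)
    (hb₀ : 0 < b₀) (ht : 0 < t) (hbt : b₀ * Real.exp t < 1) :
    ∫ y, flowRatio p q b₀ t y = ∫ y, flowRatio p q b₀ 0 y := by
  have hpm := hp.continuous.measurable
  have hlim := h.tendsto_integral_flowRatio hpm hp0 hpi hb₀ ht hbt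
  -- Conservation on `[s, t]` makes the integral at small `s > 0` equal to the one at `t`, so the
  -- limit at `0` is that constant.
  refine tendsto_nhds_unique (tendsto_const_nhds.congr' ?_) hlim
  filter_upwards [Ioo_mem_nhdsGT ht] with s hs
  have hint : ∀ {r}, 0 ≤ r → r ≤ t → Integrable (flowRatio p q b₀ r) := fun hr hrt =>
    integrable_mixRatio hpm hp0 (h.integrable hr).1 (h.measurable _ hr) (h.nonneg _ hr)
      (by positivity) (lt_one_of_lt hb₀ hrt hbt)
  have hS : IsOpen {r : ℝ | 0 < r ∧ b₀ * Real.exp r < 1} :=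
    (isOpen_lt continuous_const continuous_id).inter (isOpen_lt
      (f := fun r => b₀ * Real.exp r) (g := fun _ => 1) (by fun_prop) continuous_const)
  refine integral_eq_of_continuity_equation (q := q) (v := fun r => gradient (u r))
    (C := (1 - b₀ * Real.exp t)⁻¹) hS hs.2.le
    (fun r hr => ⟨hs.1.trans_le hr.1, lt_one_of_lt hb₀ hr.2 hbt⟩)
    (contDiffOn_flowRatio hb₀ hp hp0 h.nonneg h.contDiff)
    (fun r hr => contDiff_gradient (h.contDiff_potential r hr.1) (by norm_num))
    (fun r hr y => hasDerivAt_flowRatio hb₀ hp hp0 hr.2 (h.nonneg r hr.1.le)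
      (contDiff_slice h.contDiff hr.1) (h.contDiff_potential r hr.1) (hpu r hr.1) y
      (h.equation r hr.1 y))
    (fun r hr => h.nonneg r hr.1.le) (fun r hr => h.measurable r hr.1.le)
    (fun r hr y => ?_) (inv_nonneg.2 (by linarith)) (hint hs.1.le hs.2.le) (hint ht.le le_rfl) ?_
  · have hr0 : 0 ≤ r := hs.1.le.trans hr.1
    have hbr := lt_one_of_lt hb₀ hr.2 hbt
    have hle : b₀ * Real.exp r ≤ b₀ * Real.exp t :=
      mul_le_mul_of_nonneg_left (Real.exp_le_exp.2 hr.2) hb₀.le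
    have hb : 0 < b₀ * Real.exp r := by positivity
    rw [flowRatio, abs_of_nonneg (mixRatio_nonneg hb hbr (h.nonneg r hr0 y) (hp0 y))]
    refine (mixRatio_le hb hbr (h.nonneg r hr0 y) (hp0 y)).trans ?_
    exact mul_le_mul_of_nonneg_right (inv_anti₀ (by linarith) (by linarith)) (h.nonneg r hr0 y)
  · have := h.integrable_velocity s t hs.1 hs.2
    rwa [setLIntegral_congr_fun measurableSet_Icc fun r hr => by
      rw [h.density r (hs.1.le.trans hr.1)]] at this

/-- Start the conserved quantity at `b₀ = b e^{-t}`, so that the parameter is `b` at time `t`; the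
factor `e^{-t}` is the ratio of the prefactors `1/b` and `1/b₀`. -/
theorem IsLaplacianAdjustedFlow.mixDiv_eq
    (h : IsLaplacianAdjustedFlow ν k η q u) (hp : ContDiff ℝ 1 p) (hp0 : ∀ y, 0 < p y)
    (hpi : Integrable p) (hp1 : ∫ y, p y = 1)
    (hpu : ∀ t, 0 < t → ∀ y, divergence (fun z => p z • gradient (u t) z) y = p y - q t y)
    (ht : 0 < t) {b : ℝ} (hb : 0 < b) (hb1 : b < 1) :
    mixDiv p (q t) b =
      ENNReal.ofReal (Real.exp (-t)) * mixDiv p (q 0) (b * Real.exp (-t)) := by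
  have hpm := hp.continuous.measurable
  have hbt : b * Real.exp (-t) * Real.exp t = b := by
    rw [mul_assoc, ← Real.exp_add]
    simp
  have hb' : 0 < b * Real.exp (-t) := by positivity
  have hb1' : b * Real.exp (-t) < 1 :=
    (mul_le_of_le_one_right hb.le (Real.exp_le_one_iff.2 (by linarith))).trans_lt hb1
  have h1 := h.integral_flowRatio_eq hp hp0 hpi hpu hb' ht (by rwa [hbt])
  simp only [flowRatio, hbt, Real.exp_zero, mul_one] at h1
  rw [MirroredFlow.mixDiv_eq hpm hp0 hpi hp1 (h.integrable ht.le).1 (h.measurable t ht.le)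
      (h.nonneg t ht.le) (h.integrable ht.le).2 hb hb1,
    MirroredFlow.mixDiv_eq hpm hp0 hpi hp1 (h.integrable le_rfl).1 (h.measurable 0 le_rfl)
      (h.nonneg 0 le_rfl) (h.integrable le_rfl).2 hb' hb1', h1,
    ← ENNReal.ofReal_mul (Real.exp_pos _).le]
  congr 1
  have := (Real.exp_pos (-t)).ne'
  field_simp

/-- Exponential decay of the relative entropy, given the pointwise equation for the potential. -/
theorem IsLaplacianAdjustedFlow.klDiv_le
    (h : IsLaplacianAdjustedFlow ν k η q u) [IsProbabilityMeasure ν] (hp : ContDiff ℝ 1 p)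
    (hp0 : ∀ y, 0 < p y) (hν : ν = volume.withDensity fun y => ENNReal.ofReal (p y))
    (hpu : ∀ t, 0 < t → ∀ y, divergence (fun z => p z • gradient (u t) z) y = p y - q t y)
    (ht : 0 < t) :
    InformationTheory.klDiv (η t) ν ≤
        InformationTheory.klDiv (η 0) ν * ENNReal.ofReal (Real.exp (-t)) ∧
      (1 ≤ t → InformationTheory.klDiv (η t) ν ≤ 2 * ENNReal.ofReal (Real.exp (-t))) := by
  have hpm := hp.continuous.measurable
  obtain ⟨hpi, hp1⟩ := integrable_of_isProbabilityMeasure hpm (fun y => (hp0 y).le) hν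
  have hkl : ∀ s, 0 ≤ s → InformationTheory.klDiv (η s) ν =
      ∫⁻ b in Ioo (0 : ℝ) 1, mixDiv p (q s) b := fun s hs => by
    have := h.prob s hs
    exact klDiv_eq_lintegral_mixDiv hpm hp0 (h.measurable s hs) (h.nonneg s hs) hν
      (h.density s hs)
  have hexp : Real.exp (-t) ≤ 1 := Real.exp_le_one_iff.2 (by linarith)
  rw [hkl t ht.le, hkl 0 le_rfl]
  constructor
  · rw [mul_comm, ← lintegral_const_mul' _ _ ENNReal.ofReal_ne_top]
    refine setLIntegral_mono' measurableSet_Ioo fun b hb => ?_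
    have hb0 : 0 < b := hb.1
    rw [h.mixDiv_eq hp hp0 hpi hp1 hpu ht hb.1 hb.2]
    gcongr
    exact mixDiv_mono hp0 (h.nonneg 0 le_rfl) (by positivity)
      (mul_le_of_le_one_right hb0.le hexp) hb.2
  · intro h1t
    calc ∫⁻ b in Ioo (0 : ℝ) 1, mixDiv p (q t) b
        ≤ ∫⁻ _ in Ioo (0 : ℝ) 1, 2 * ENNReal.ofReal (Real.exp (-t)) := by
          refine setLIntegral_mono' measurableSet_Ioo fun b hb => ?_
          have hb0 : 0 < b := hb.1
          -- For `t ≥ 1`, `eᵗ ≥ t + 1 ≥ 2`. Hence `b e^{-t} ≤ 1/2`, and the a priori bound `1/(1 - b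
          -- e^{-t})` is at most `2`.
          have he : Real.exp (-t) ≤ 1 / 2 := by
            rw [Real.exp_neg, ← one_div]
            refine one_div_le_one_div_of_le two_pos ?_
            have := Real.add_one_le_exp t
            linarith
          have hbe : b * Real.exp (-t) ≤ 1 / 2 := by
            have := mul_le_of_le_one_left (Real.exp_pos (-t)).le hb.2.le
            linarith
          rw [h.mixDiv_eq hp hp0 hpi hp1 hpu ht hb.1 hb.2, mul_comm]
          gcongr
          refine (mixDiv_le hpm hp0 hpi hp1 (h.integrable le_rfl).1 (h.measurable 0 le_rfl)
            (h.nonneg 0 le_rfl) (h.integrable le_rfl).2 (by positivity) (by linarith)).trans ?_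
          rw [← ENNReal.ofReal_ofNat]
          refine ENNReal.ofReal_le_ofReal ?_
          rw [inv_le_comm₀ (by linarith) two_pos]
          linarith
      _ = 2 * ENNReal.ofReal (Real.exp (-t)) := by simp

/-- The choice of kernel enters here: `-L u_t` equals `η_t/ν` minus its mean, and multiplying by the
density of `ν` gives the divergence equation. -/
theorem IsLaplacianAdjustedFlow.divergence_eq {W : Euc d → ℝ} {c : ℝ}
    (h : IsLaplacianAdjustedFlow ν k η q u) [IsProbabilityMeasure ν] (hW : ContDiff ℝ 1 W)
    (hc : 0 < c) (hν : ν = volume.withDensity fun y => ENNReal.ofReal (c * Real.exp (-W y)))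
    (hk : IsNegInverse ν k (generator W ν)) (ht : 0 < t) (y : Euc d) :
    divergence (fun z => (c * Real.exp (-W z)) • gradient (u t) z) y =
      c * Real.exp (-W y) - q t y := by
  have hp := contDiff_gibbs (c := c) hW
  have hpm := hp.continuous.measurable
  have hp0 : ∀ y, 0 < c * Real.exp (-W y) := fun y => by positivity
  have hprob := h.prob t ht.le
  have hρ := relDensity_ae_eq hpm hp0 (h.measurable t ht.le) (h.nonneg t ht.le) hν
    (h.density t ht.le)
  have hac : η t ≪ ν := by
    rw [withDensity_eq_withDensity_div hpm hp0 (h.measurable t ht.le) hν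
      (h.density t ht.le)]
    exact withDensity_absolutelyContinuous _ _
  have hf := (h.memLp t ht).coeFn_toLp
  obtain ⟨-, g, f, hg, -, hfe, hmem⟩ := hk ((h.memLp t ht).toLp _)
  -- The mean subtracted by the inverse is the total mass of `η_t`.
  have hone : ∫ z, (h.memLp t ht).toLp _ z ∂ν = 1 := by
    rw [integral_congr_ae hf]
    simp only [relDensity]
    rw [Measure.integral_toReal_rnDeriv hac]
    simp
  rw [hone] at hfe
  have hker : kernelOp ν k ((h.memLp t ht).toLp _) = kernelOp ν k (relDensity (η t) ν) := by
    funext z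
    refine integral_congr_ae ?_
    filter_upwards [hf] with x hx
    rw [hx]
  rw [hker] at hg
  refine divergence_eq_of_mem_generator (r := fun y => c * Real.exp (-W y) - q t y) hW hc hν hmem
    (h.contDiff_potential t ht) (hg.trans (h.potential t ht).symm)
    (hp.continuous.sub (contDiff_slice h.contDiff ht).continuous) ?_ y
  filter_upwards [Lp.coeFn_neg f, hfe, hf, hρ] with z h1 h2 h3 h4
  rw [h1, Pi.neg_apply, h2, h3, h4, sub_div, div_self (hp0 z).ne']
  ring

end Invariance

end MirroredFlow

end

/-! ### Transfer of the decay back to the primal flow -/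

theorem mainTheorem10 (d : ℕ) (X : Set (MirroredFlow.Euc d)) (φ : MirroredFlow.Euc d → EReal)
    (hφ : MirroredFlow.IsMirrorFunction X φ)
    (V : MirroredFlow.Euc d → ℝ) (π : Measure (MirroredFlow.Euc d))
    (hπ : MirroredFlow.IsTarget X V π)
    (κ : ℝ) (hκ : 0 < κ) (hPI : MirroredFlow.MirroredPoincare X φ π κ)
    (hspec : MirroredFlow.HasDiscreteSpectrum
      (MirroredFlow.generator (MirroredFlow.mirroredPotential X φ V)
        (MirroredFlow.mirrored φ π)))
    (k : MirroredFlow.Euc d → MirroredFlow.Euc d → ℝ)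
    (hk : MirroredFlow.IsNegInverse (MirroredFlow.mirrored φ π) (MirroredFlow.dualKernel X φ k)
      (MirroredFlow.generator (MirroredFlow.mirroredPotential X φ V)
        (MirroredFlow.mirrored φ π)))
    (μ : ℝ → Measure (MirroredFlow.Euc d)) (hμ : MirroredFlow.IsMLAWGF X φ π k μ) :
    (∀ t : ℝ, 0 ≤ t → InformationTheory.klDiv (μ t) π ≤
      InformationTheory.klDiv (μ 0) π * ENNReal.ofReal (Real.exp (-t))) ∧
    (∀ t : ℝ, 1 ≤ t → InformationTheory.klDiv (μ t) π ≤
      min (InformationTheory.klDiv (μ 0) π) 2 * ENNReal.ofReal (Real.exp (-t))) := by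
  obtain ⟨η, q, u, hflow, hη⟩ := hμ
  have hprob := hπ.isProbabilityMeasure_mirrored hφ
  obtain ⟨c, hc, hν⟩ := hπ.exists_density_mirrored hφ
  have hW := hφ.contDiff_mirroredPotential hπ.smooth
  have hkl : ∀ t, 0 ≤ t → InformationTheory.klDiv (μ t) π =
      InformationTheory.klDiv (η t) (MirroredFlow.mirrored φ π) := fun t ht => by
    have := hflow.prob t ht
    rw [hη t ht, hπ.klDiv_map_dualMap hφ]
  have hdecay := fun (t : ℝ) (ht : 0 < t) => hflow.klDiv_le (MirroredFlow.contDiff_gibbs hW)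
    (fun y => mul_pos hc (Real.exp_pos _)) hν
    (fun s hs y => hflow.divergence_eq hW hc hν hk hs y) ht
  constructor
  · intro t ht
    rcases ht.eq_or_lt with rfl | ht0
    · simp
    · rw [hkl t ht, hkl 0 le_rfl]
      exact (hdecay t ht0).1
  · intro t ht
    have ht0 : 0 < t := by linarith
    rw [hkl t ht0.le, hkl 0 le_rfl]
    rcases min_choice (InformationTheory.klDiv (η 0) (MirroredFlow.mirrored φ π)) 2 with h | h
    · rw [h]
      exact (hdecay t ht0).1
    · rw [h]
      exact (hdecay t ht0).2 ht
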